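/- Let $N\ge 1$, $\Gamma=\Gamma(N)\subset SL_2(\mathbb Z)$ and $\sigma\in SL_2(\mathbb Z)$. **Notation.** For $\alpha=\begin{pmatrix}a&b\\c&d\end{pmatrix}\in GL_2^+(\mathbb Q)$ and $f:\mathbb H\to\mathbb C$ put $(f|_k\alpha)(z)=\det(\alpha)^{k/2}(cz+d)^{-k}f\left(\frac{az+b}{cz+d}\right)$. Let $\mathcal M=\bigoplus_{k\ge 0}\bigcup_{M\ge1}\mathcal M_k(\Gamma(M))$ be the tower of modular forms, and $\mathcal{QM}$ the tower of quasimodular forms, i.e. the span of all holomorphic $f:\mathbb H\to\mathbb C$ such that for some $M\ge 1$, $k,s\ge 0$ there are holomorphic $f_0,\dots,f_s:\mathbb H\to\mathbb C$, $f_s\neq 0$, with $(f|_k\gamma)(z)=\sum_{j=0}^s f_j(z)\left(\frac{c}{cz+d}\right)^j$ for all $\gamma=\begin{pmatrix}a&b\\c&d\end{pmatrix}\in\Gamma(M)$, and with each $f_j|_{k-2j}\alpha$ ($\alpha\in SL_2(\mathbb Z)$) bounded at $i\infty$. Let $G_2(z)=-\frac1{24}+\sum_{n\ge1}\sigma_1(n)e^{2\pi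 i n z}$ and let $\Delta$ be the discriminant modular form of weight $12$. By the structure theorem of Kaneko and Zagier every $f\in\mathcal{QM}$ is uniquely of the form $f=\sum_i a_i(f)G_2^i$ with $a_i(f)\in\mathcal M$. On modular forms $g$ of weight $k$ set $Y(g)=\frac k2 g$ and $X(g)=\frac1{2\pi i}\frac{dg}{dz}-\frac1{12\pi i}\frac{d}{dz}(\log\Delta)\,Y(g)$, extend these and $|\alpha:=|_k\alpha$ linearly to $\mathcal M$, and for $f\in\mathcal{QM}$ set $$f||\alpha=\sum_i (a_i(f)|\alpha)G_2^i,\qquad X(f)=\sum_i X(a_i(f))G_2^i,\qquad Y(f)=\sum_i Y(a_i(f))G_2^i .$$ For $\delta\in GL_2^+(\mathbb Q)$ put $\mu_\delta=\frac1{12\pi i}\frac{d}{dz}\log\frac{\Delta|_{12}\delta}{\Delta}$. Let $\mathcal Q_\sigma(\Gamma)$ be the space of functions of finite support $F:\Gamma\backslash GL_2^+(\mathbb Q)\to\mathcal{QM}$, $\Gamma\alpha\mapsto F_\alpha$, with $F_{\alpha\gamma}=F_\alpha||\sigma\gamma\sigma^{-1}$ for all $\gamma\in\Gamma$, and let $\mathcal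 Q(\Gamma)=\mathcal Q_1(\Gamma)$. For $F^1\in\mathcal Q_\sigma(\Gamma)$ and $F^2\in\mathcal Q(\Gamma)$ put $$(F^1*F^2)_\alpha=\sum_{\beta\in\Gamma\backslash GL_2^+(\mathbb Q)}F^1_{\beta\sigma}\cdot\left(F^2_{\alpha\sigma^{-1}\beta^{-1}}||\beta\right).$$ Let $\mathcal H_1$ be the complex Hopf algebra that as an algebra is the universal enveloping algebra of the Lie algebra with generators $X,Y,\delta_n$ ($n\ge1$) and relations $[Y,X]=X$, $[X,\delta_n]=\delta_{n+1}$, $[Y,\delta_n]=n\delta_n$, $[\delta_k,\delta_l]=0$, with coproduct determined by $\Delta(X)=X\otimes1+1\otimes X+\delta_1\otimes Y$, $\Delta(Y)=Y\otimes1+1\otimes Y$, $\Delta(\delta_1)=\delta_1\otimes1+1\otimes\delta_1$. **Theorem.** The product $*$ is well defined and bilinear, takes values in $\mathcal Q_\sigma(\Gamma)$, and is a right action: $(F^1*F^2)*F^3=F^1*(F^2*F^3)$ for $F^1\in\mathcal Q_\sigma(\Gamma)$, $F^2,F^3\in\mathcal Q(\Gamma)$. Moreover: (a) $\mathcal Q_\sigma(\Gamma)$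 is an $\mathcal H_1$-module via $$X(F)_\alpha=X(F_\alpha),\qquad Y(F)_\alpha=Y(F_\alpha),\qquad \delta_n(F)_\alpha=X^{n-1}(\mu_{\alpha\sigma^{-1}})\cdot F_\alpha\qquad(n\ge1,\ \alpha\in GL_2^+(\mathbb Q)).$$ (b) With this action on $\mathcal Q_\sigma(\Gamma)$, and the one for $\sigma=1$ on $\mathcal Q(\Gamma)$, $\mathcal H_1$ has a Hopf action on the right $\mathcal Q(\Gamma)$-module $\mathcal Q_\sigma(\Gamma)$: for all $h\in\mathcal H_1$, $F^1\in\mathcal Q_\sigma(\Gamma)$, $F^2\in\mathcal Q(\Gamma)$, $$h(F^1*F^2)=\sum h_{(1)}(F^1)*h_{(2)}(F^2),\qquad \Delta(h)=\sum h_{(1)}\otimes h_{(2)}.$$ -/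

import Mathlib

open scoped MatrixGroups Manifold TensorProduct DirectSum ModularForm

noncomputable section

namespace QMHecke

/-- Symbols for the generators `X`, `Y`, `δ₁, δ₂, …`; the symbol `d n` stands for `δ_{n+1}`. -/
inductive Gen : Type
  | x : Gen
  | y : Gen
  | d : ℕ → Gen

section LieAlgebraL1

/-- The relations `[Y,X] = X`, `[X,δ_n] = δ_{n+1}`, `[Y,δ_n] = n δ_n`, `[δ_k,δ_l] = 0`. -/
inductive Relator : FreeLieAlgebra ℂ Gen → Prop
  | yx : Relator (⁅FreeLieAlgebra.of ℂ Gen.y, FreeLieAlgebra.of ℂ Gen.x⁆ - FreeLieAlgebra.of ℂ Gen.x)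
  | xd (n : ℕ) : Relator (⁅FreeLieAlgebra.of ℂ Gen.x, FreeLieAlgebra.of ℂ (Gen.d n)⁆ - FreeLieAlgebra.of ℂ (Gen.d (n + 1)))
  | yd (n : ℕ) : Relator (⁅FreeLieAlgebra.of ℂ Gen.y, FreeLieAlgebra.of ℂ (Gen.d n)⁆ - ((n : ℂ) + 1) • FreeLieAlgebra.of ℂ (Gen.d n))
  | dd (k l : ℕ) : Relator ⁅FreeLieAlgebra.of ℂ (Gen.d k), FreeLieAlgebra.of ℂ (Gen.d l)⁆

/-- The ideal of the free Lie algebra generated by the relations. -/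
def relIdeal : LieIdeal ℂ (FreeLieAlgebra ℂ Gen) :=
  LieSubmodule.lieSpan ℂ (FreeLieAlgebra ℂ Gen) {r | Relator r}

/-- The complex Lie algebra `𝓛₁` with generators `X`, `Y`, `δ_n` (`n ≥ 1`) and the relations
above. -/
abbrev L1 : Type := FreeLieAlgebra ℂ Gen ⧸ relIdeal

/-- The quotient map. -/
def toL1 : FreeLieAlgebra ℂ Gen →ₗ⁅ℂ⁆ L1 where
  toLinearMap := (LieSubmodule.Quotient.mk' relIdeal : FreeLieAlgebra ℂ Gen →ₗ[ℂ] L1)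
  map_lie' := rfl

theorem toL1_relator {r : FreeLieAlgebra ℂ Gen} (h : Relator r) : toL1 r = 0 :=
  (LieSubmodule.Quotient.mk_eq_zero').mpr (LieSubmodule.subset_lieSpan h)

/-- The universal property of `𝓛₁`. -/
def liftL1 {L : Type*} [LieRing L] [LieAlgebra ℂ L] (f : FreeLieAlgebra ℂ Gen →ₗ⁅ℂ⁆ L)
    (hf : ∀ r, Relator r → f r = 0) : L1 →ₗ⁅ℂ⁆ L where
  toLinearMap := Submodule.liftQ relIdeal.toSubmodule (f : FreeLieAlgebra ℂ Gen →ₗ[ℂ] L) <| by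
    intro x hx
    have h : relIdeal ≤ f.ker :=
      LieSubmodule.lieSpan_le.mpr fun r hr => (LieHom.mem_ker).mpr (hf r hr)
    exact (LieHom.mem_ker).mp (h hx)
  map_lie' := by
    intro a b
    induction a using Quotient.inductionOn'
    induction b using Quotient.inductionOn'
    exact f.map_lie _ _

theorem liftL1_toL1 {L : Type*} [LieRing L] [LieAlgebra ℂ L] (f : FreeLieAlgebra ℂ Gen →ₗ⁅ℂ⁆ L)
    (hf : ∀ r, Relator r → f r = 0) (r : FreeLieAlgebra ℂ Gen) : liftL1 f hf (toL1 r) = f r := rfl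

end LieAlgebraL1

/-- The algebra `𝓗₁`, the universal enveloping algebra of `𝓛₁`. -/
def H1 : Type := UniversalEnvelopingAlgebra ℂ L1

namespace H1

instance : Ring H1 := inferInstanceAs (Ring (UniversalEnvelopingAlgebra ℂ L1))
instance : Algebra ℂ H1 := inferInstanceAs (Algebra ℂ (UniversalEnvelopingAlgebra ℂ L1))

section Construction

attribute [local instance 100] LieRing.ofAssociativeRing

/-- The canonical Lie map to `𝓗₁`. -/
def incl : FreeLieAlgebra ℂ Gen →ₗ⁅ℂ⁆ H1 :=
  LieHom.comp (UniversalEnvelopingAlgebra.ι ℂ : L1 →ₗ⁅ℂ⁆ UniversalEnvelopingAlgebra ℂ L1) toL1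

/-- The image in `𝓗₁` of a generator. -/
def gen (g : Gen) : H1 := incl (FreeLieAlgebra.of ℂ g)

/-- The generator `X`. -/
def X : H1 := gen Gen.x

/-- The generator `Y`. -/
def Y : H1 := gen Gen.y

/-- The generators `δ_n`: `δ n` stands for `δ_{n+1}`. -/
def δ (n : ℕ) : H1 := gen (Gen.d n)

theorem incl_relator {r : FreeLieAlgebra ℂ Gen} (h : Relator r) : incl r = 0 := by
  change UniversalEnvelopingAlgebra.ι ℂ (toL1 r) = 0
  rw [toL1_relator h, map_zero]

theorem Y_X : Y * X - X * Y = X := by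
  have h := incl_relator Relator.yx
  rwa [map_sub, LieHom.map_lie, sub_eq_zero] at h

theorem X_δ (n : ℕ) : X * δ n - δ n * X = δ (n + 1) := by
  have h := incl_relator (Relator.xd n)
  rwa [map_sub, LieHom.map_lie, sub_eq_zero] at h

theorem Y_δ (n : ℕ) : Y * δ n - δ n * Y = ((n : ℂ) + 1) • δ n := by
  have h := incl_relator (Relator.yd n)
  rwa [map_sub, LieHom.map_lie, map_smul, sub_eq_zero] at h

theorem δ_δ (k l : ℕ) : δ k * δ l = δ l * δ k := by
  have h := incl_relator (Relator.dd k l)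
  rwa [LieHom.map_lie, LieRing.of_associative_ring_bracket, sub_eq_zero] at h

section lift

variable {A : Type*} [Ring A] [Algebra ℂ A]

/-- The universal property of `𝓗₁` as the algebra with generators `X`, `Y`, `δ_n`. -/
theorem exists_lift (x y : A) (d : ℕ → A) (hyx : y * x - x * y = x)
    (hxd : ∀ n, x * d n - d n * x = d (n + 1))
    (hyd : ∀ n, y * d n - d n * y = ((n : ℂ) + 1) • d n)
    (hdd : ∀ k l, d k * d l = d l * d k) :
    ∃ f : H1 →ₐ[ℂ] A, f X = x ∧ f Y = y ∧ ∀ n, f (δ n) = d n := by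
  let v : Gen → A := fun g => match g with
    | Gen.x => x
    | Gen.y => y
    | Gen.d n => d n
  let φ : FreeLieAlgebra ℂ Gen →ₗ⁅ℂ⁆ A := FreeLieAlgebra.lift ℂ v
  have hφ : ∀ r, Relator r → φ r = 0 := by
    intro r hr
    cases hr with
    | yx => simpa [φ, v, LieRing.of_associative_ring_bracket, sub_eq_zero] using hyx
    | xd n => simpa [φ, v, LieRing.of_associative_ring_bracket, sub_eq_zero] using hxd n
    | yd n => simpa [φ, v, LieRing.of_associative_ring_bracket, sub_eq_zero] using hyd n
    | dd k l => simpa [φ, v, LieRing.of_associative_ring_bracket, sub_eq_zero] using hdd k l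
  let F : UniversalEnvelopingAlgebra ℂ L1 →ₐ[ℂ] A :=
    UniversalEnvelopingAlgebra.lift ℂ (liftL1 φ hφ)
  have hF : ∀ g, F (gen g) = v g := fun g =>
    (UniversalEnvelopingAlgebra.lift_ι_apply ℂ (liftL1 φ hφ) (toL1 (FreeLieAlgebra.of ℂ g))).trans
      (FreeLieAlgebra.lift_of_apply v g)
  exact ⟨F, hF Gen.x, hF Gen.y, fun n => hF (Gen.d n)⟩

theorem hom_ext {f g : H1 →ₐ[ℂ] A} (hx : f X = g X) (hy : f Y = g Y) (hd : f (δ 0) = g (δ 0)) :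
    f = g := by
  have hδ : ∀ n, f (δ n) = g (δ n) := by
    intro n
    induction n with
    | zero => exact hd
    | succ n ih => rw [← X_δ n]; simp only [map_sub, map_mul, hx, ih]
  refine UniversalEnvelopingAlgebra.hom_ext (R := ℂ) (L := L1) (A := A) ?_
  have key : ((f : H1 →ₗ⁅ℂ⁆ A).comp incl) = ((g : H1 →ₗ⁅ℂ⁆ A).comp incl) := by
    refine FreeLieAlgebra.hom_ext fun t => ?_
    cases t with
    | x => exact hx
    | y => exact hy
    | d n => exact hδ n
  refine LieHom.ext fun a => ?_
  obtain ⟨r, rfl⟩ := LieSubmodule.Quotient.surjective_mk' relIdeal a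
  exact LieHom.congr_fun key r

end lift

section Hopf

/-- The commutative subalgebra generated by the `δ_n`. -/
def D : Subalgebra ℂ H1 := Algebra.adjoin ℂ (Set.range δ)

theorem δ_mem (n : ℕ) : δ n ∈ D := Algebra.subset_adjoin ⟨n, rfl⟩

theorem D_comm {u v : H1} (hu : u ∈ D) (hv : v ∈ D) : u * v = v * u := by
  refine Algebra.adjoin_induction₂ (hx := hu) (hy := hv) (p := fun x y _ _ => x * y = y * x)
    ?_ ?_ ?_ ?_ ?_ ?_ ?_ ?_
  · rintro _ _ ⟨k, rfl⟩ ⟨l, rfl⟩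
    exact δ_δ k l
  · intro r s
    exact (map_mul (algebraMap ℂ H1) r s).symm.trans
      ((congrArg _ (mul_comm r s)).trans (map_mul _ _ _))
  · intro r x _
    exact Algebra.commutes r x
  · intro r x _
    exact (Algebra.commutes r x).symm
  · intro x y z _ _ _ h1 h2
    rw [add_mul, mul_add, h1, h2]
  · intro x y z _ _ _ h1 h2
    rw [add_mul, mul_add, h1, h2]
  · intro x y z _ _ _ h1 h2
    rw [mul_assoc, h2, ← mul_assoc, h1, mul_assoc]
  · intro x y z _ _ _ h1 h2
    rw [← mul_assoc, h1, mul_assoc, h2, mul_assoc]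

theorem ad_mem {z : H1} (hz : ∀ n, z * δ n - δ n * z ∈ D) {u : H1} (hu : u ∈ D) :
    z * u - u * z ∈ D := by
  refine Algebra.adjoin_induction (hx := hu) (p := fun u _ => z * u - u * z ∈ D) ?_ ?_ ?_ ?_
  · rintro _ ⟨n, rfl⟩
    exact hz n
  · intro r
    rw [Algebra.commutes r z, sub_self]
    exact D.zero_mem
  · intro a b _ _ ha hb
    have h : z * (a + b) - (a + b) * z = (z * a - a * z) + (z * b - b * z) := by noncomm_ring
    rw [h]
    exact D.add_mem ha hb
  · intro a b ha' hb' ha hb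
    have h : z * (a * b) - (a * b) * z = (z * a - a * z) * b + a * (z * b - b * z) := by
      noncomm_ring
    rw [h]
    exact D.add_mem (D.mul_mem ha hb') (D.mul_mem ha' hb)

theorem adX_mem {u : H1} (hu : u ∈ D) : X * u - u * X ∈ D :=
  ad_mem (fun n => by rw [X_δ]; exact δ_mem _) hu

theorem adY_mem {u : H1} (hu : u ∈ D) : Y * u - u * Y ∈ D :=
  ad_mem (fun n => by rw [Y_δ]; exact D.smul_mem (δ_mem _) _) hu

/-- `X ⊗ 1 + 1 ⊗ X + δ₁ ⊗ Y`. -/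
def cX : H1 ⊗[ℂ] H1 := X ⊗ₜ 1 + 1 ⊗ₜ X + δ 0 ⊗ₜ Y

/-- `Y ⊗ 1 + 1 ⊗ Y`. -/
def cY : H1 ⊗[ℂ] H1 := Y ⊗ₜ 1 + 1 ⊗ₜ Y

/-- `δ₁ ⊗ 1 + 1 ⊗ δ₁` and its iterated commutators with `cX`. -/
def cδ : ℕ → H1 ⊗[ℂ] H1
  | 0 => δ 0 ⊗ₜ 1 + 1 ⊗ₜ δ 0
  | n + 1 => cX * cδ n - cδ n * cX

/-- `D ⊗ D`. -/
def DD : Submodule ℂ (H1 ⊗[ℂ] H1) := Submodule.span ℂ {t | ∃ u ∈ D, ∃ v ∈ D, t = u ⊗ₜ[ℂ] v}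

theorem tmul_mem_DD {u v : H1} (hu : u ∈ D) (hv : v ∈ D) : u ⊗ₜ[ℂ] v ∈ DD :=
  Submodule.subset_span ⟨u, hu, v, hv, rfl⟩

theorem DD_comm {s t : H1 ⊗[ℂ] H1} (hs : s ∈ DD) (ht : t ∈ DD) : s * t = t * s := by
  induction hs using Submodule.span_induction with
  | zero => rw [zero_mul, mul_zero]
  | add a b _ _ ha hb => rw [add_mul, mul_add, ha, hb]
  | smul c a _ ha => rw [smul_mul_assoc, mul_smul_comm, ha]
  | mem a ha =>
    obtain ⟨u, hu, v, hv, rfl⟩ := ha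
    induction ht using Submodule.span_induction with
    | zero => rw [zero_mul, mul_zero]
    | add a b _ _ ha hb => rw [add_mul, mul_add, ha, hb]
    | smul c a _ ha => rw [smul_mul_assoc, mul_smul_comm, ha]
    | mem b hb =>
      obtain ⟨u', hu', v', hv', rfl⟩ := hb
      rw [Algebra.TensorProduct.tmul_mul_tmul, Algebra.TensorProduct.tmul_mul_tmul,
        D_comm hu hu', D_comm hv hv']

theorem adcX_mem {t : H1 ⊗[ℂ] H1} (ht : t ∈ DD) : cX * t - t * cX ∈ DD := by
  induction ht using Submodule.span_induction with
  | zero => simp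
  | add a b _ _ ha hb =>
    have h : cX * (a + b) - (a + b) * cX = (cX * a - a * cX) + (cX * b - b * cX) := by
      noncomm_ring
    rw [h]
    exact DD.add_mem ha hb
  | smul c a _ ha =>
    rw [smul_mul_assoc, mul_smul_comm, ← smul_sub]
    exact DD.smul_mem c ha
  | mem a ha =>
    obtain ⟨u, hu, v, hv, rfl⟩ := ha
    have h : cX * (u ⊗ₜ[ℂ] v) - (u ⊗ₜ[ℂ] v) * cX = (X * u - u * X) ⊗ₜ[ℂ] v +
        u ⊗ₜ[ℂ] (X * v - v * X) + (δ 0 * u) ⊗ₜ[ℂ] (Y * v - v * Y) := by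
      simp only [cX, add_mul, mul_add, Algebra.TensorProduct.tmul_mul_tmul, one_mul, mul_one,
        TensorProduct.sub_tmul, TensorProduct.tmul_sub, D_comm hu (δ_mem 0)]
      abel
    rw [h]
    exact DD.add_mem (DD.add_mem (tmul_mem_DD (adX_mem hu) hv) (tmul_mem_DD hu (adX_mem hv)))
      (tmul_mem_DD (D.mul_mem (δ_mem 0) hu) (adY_mem hv))

theorem cδ_mem (n : ℕ) : cδ n ∈ DD := by
  induction n with
  | zero => exact DD.add_mem (tmul_mem_DD (δ_mem 0) D.one_mem) (tmul_mem_DD D.one_mem (δ_mem 0))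
  | succ n ih => exact adcX_mem ih

theorem cY_cX : cY * cX - cX * cY = cX := by
  have h1 : Y * X = X * Y + X := by rw [← sub_eq_iff_eq_add']; exact Y_X
  have h2 : Y * δ 0 = δ 0 * Y + δ 0 := by
    rw [← sub_eq_iff_eq_add', Y_δ]; simp
  simp only [cX, cY, add_mul, mul_add, Algebra.TensorProduct.tmul_mul_tmul, one_mul, mul_one, h1,
    h2, TensorProduct.add_tmul, TensorProduct.tmul_add]
  abel

/-- In any algebra, the relation `[y, d_n] = n d_n` propagates from `n = 1`. -/
theorem weight_step {A : Type*} [Ring A] [Algebra ℂ A] {x y : A} {d : ℕ → A}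
    (hyx : y * x - x * y = x) (hxd : ∀ n, x * d n - d n * x = d (n + 1))
    (h0 : y * d 0 - d 0 * y = d 0) (n : ℕ) :
    y * d n - d n * y = ((n : ℂ) + 1) • d n := by
  induction n with
  | zero => simpa using h0
  | succ n ih =>
    have h : y * d (n + 1) - d (n + 1) * y = (y * x - x * y) * d n - d n * (y * x - x * y) +
        (x * (y * d n - d n * y) - (y * d n - d n * y) * x) := by
      rw [← hxd n]; noncomm_ring
    rw [h, hyx, ih, mul_smul_comm, smul_mul_assoc, ← smul_sub, hxd n]
    push_cast
    rw [add_smul (_ + _), one_smul, add_comm]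

theorem cY_cδ (n : ℕ) : cY * cδ n - cδ n * cY = ((n : ℂ) + 1) • cδ n := by
  refine weight_step cY_cX (fun _ => rfl) ?_ n
  have h2 : Y * δ 0 = δ 0 * Y + δ 0 := by
    rw [← sub_eq_iff_eq_add', Y_δ]; simp
  simp only [cδ, cY, add_mul, mul_add, Algebra.TensorProduct.tmul_mul_tmul, one_mul, mul_one,
    h2, TensorProduct.add_tmul, TensorProduct.tmul_add]
  abel

theorem exists_comul : ∃ Δ : H1 →ₐ[ℂ] H1 ⊗[ℂ] H1, Δ X = cX ∧ Δ Y = cY ∧ ∀ n, Δ (δ n) = cδ n :=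
  exists_lift cX cY cδ cY_cX (fun _ => rfl) cY_cδ fun k l => DD_comm (cδ_mem k) (cδ_mem l)

theorem exists_counit : ∃ ε : H1 →ₐ[ℂ] ℂ, ε X = 0 ∧ ε Y = 0 ∧ ∀ n, ε (δ n) = 0 :=
  exists_lift 0 0 (fun _ => 0) (by simp) (by simp) (by simp) (by simp)

/-- The coproduct of `𝓗₁`: the algebra map with `Δ(X) = X ⊗ 1 + 1 ⊗ X + δ₁ ⊗ Y`,
`Δ(Y) = Y ⊗ 1 + 1 ⊗ Y`, `Δ(δ₁) = δ₁ ⊗ 1 + 1 ⊗ δ₁`. -/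
def comulHom : H1 →ₐ[ℂ] H1 ⊗[ℂ] H1 := exists_comul.choose

/-- The counit of `𝓗₁`. -/
def counitHom : H1 →ₐ[ℂ] ℂ := exists_counit.choose

theorem comulHom_X : comulHom X = X ⊗ₜ 1 + 1 ⊗ₜ X + δ 0 ⊗ₜ Y := exists_comul.choose_spec.1
theorem comulHom_Y : comulHom Y = Y ⊗ₜ 1 + 1 ⊗ₜ Y := exists_comul.choose_spec.2.1
theorem comulHom_δ : comulHom (δ 0) = δ 0 ⊗ₜ 1 + 1 ⊗ₜ δ 0 := exists_comul.choose_spec.2.2 0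
theorem counitHom_X : counitHom X = 0 := exists_counit.choose_spec.1
theorem counitHom_Y : counitHom Y = 0 := exists_counit.choose_spec.2.1
theorem counitHom_δ : counitHom (δ 0) = 0 := exists_counit.choose_spec.2.2 0

instance : Bialgebra ℂ H1 :=
  Bialgebra.ofAlgHom comulHom counitHom
    (by
      apply hom_ext <;>
      simp [comulHom_X, comulHom_Y, comulHom_δ, TensorProduct.add_tmul, TensorProduct.tmul_add,
        Algebra.TensorProduct.one_def] <;> abel)
    (by
      apply hom_ext <;>
      simp [comulHom_X, comulHom_Y, comulHom_δ, counitHom_X, counitHom_Y, counitHom_δ])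
    (by
      apply hom_ext <;>
      simp [comulHom_X, comulHom_Y, comulHom_δ, counitHom_X, counitHom_Y, counitHom_δ])

theorem comul_eq (h : H1) : Coalgebra.comul (R := ℂ) h = comulHom h := rfl

theorem counit_eq (h : H1) : Coalgebra.counit (R := ℂ) h = counitHom h := rfl

/-- The elements `S(δ_n)`. -/
def sδ : ℕ → H1
  | 0 => -δ 0
  | n + 1 => sδ n * (-X + δ 0 * Y) - (-X + δ 0 * Y) * sδ n

theorem sδ_mem (n : ℕ) : sδ n ∈ D := by
  induction n with
  | zero => exact D.neg_mem (δ_mem 0)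
  | succ n ih =>
    have h : sδ (n + 1) = (X * sδ n - sδ n * X) - δ 0 * (Y * sδ n - sδ n * Y) := by
      have e : sδ n * (δ 0 * Y) = δ 0 * (sδ n * Y) := by
        rw [← mul_assoc, D_comm ih (δ_mem 0), mul_assoc]
      simp only [sδ, mul_add, add_mul, mul_sub, e, mul_neg, neg_mul, mul_assoc]
      abel
    rw [h]
    exact D.sub_mem (adX_mem ih) (D.mul_mem (δ_mem 0) (adY_mem ih))

open MulOpposite in
theorem exists_antipode : ∃ S : H1 →ₐ[ℂ] H1ᵐᵒᵖ,
    S X = op (-X + δ 0 * Y) ∧ S Y = op (-Y) ∧ ∀ n, S (δ n) = op (sδ n) := by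
  have h2 : Y * δ 0 = δ 0 * Y + δ 0 := by
    rw [← sub_eq_iff_eq_add', Y_δ]; simp
  have h1 : Y * X = X * Y + X := by rw [← sub_eq_iff_eq_add']; exact Y_X
  have hyx : op (-Y) * op (-X + δ 0 * Y) - op (-X + δ 0 * Y) * op (-Y) = op (-X + δ 0 * Y) := by
    rw [← op_mul, ← op_mul, ← op_sub]
    congr 1
    have e : Y * (δ 0 * Y) = δ 0 * Y * Y + δ 0 * Y := by rw [← mul_assoc, h2, add_mul]
    simp only [add_mul, mul_add, neg_mul, mul_neg, neg_neg, h1, e]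
    abel
  have hxd : ∀ n, op (-X + δ 0 * Y) * op (sδ n) - op (sδ n) * op (-X + δ 0 * Y) =
      op (sδ (n + 1)) := fun n => rfl
  refine exists_lift (op (-X + δ 0 * Y)) (op (-Y)) (fun n => op (sδ n)) hyx hxd
    (weight_step hyx hxd ?_) fun k l => ?_
  · rw [← op_mul, ← op_mul, ← op_sub]
    congr 1
    simp only [sδ, neg_mul, mul_neg, neg_neg, h2]
    abel
  · rw [← op_mul, ← op_mul, D_comm (sδ_mem l) (sδ_mem k)]

/-- The antipode of `𝓗₁`, as an algebra map to the opposite algebra. -/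
def antipodeHom : H1 →ₐ[ℂ] H1ᵐᵒᵖ := exists_antipode.choose

/-- The antipode of `𝓗₁`: the anti-multiplicative map with `S(X) = -X + δ₁ Y`, `S(Y) = -Y`,
`S(δ₁) = -δ₁`. -/
def S : H1 →ₗ[ℂ] H1 :=
  (MulOpposite.opLinearEquiv ℂ).symm.toLinearMap ∘ₗ antipodeHom.toLinearMap

theorem S_X : S X = -X + δ 0 * Y :=
  congrArg MulOpposite.unop exists_antipode.choose_spec.1
theorem S_Y : S Y = -Y := congrArg MulOpposite.unop exists_antipode.choose_spec.2.1
theorem S_δ : S (δ 0) = -δ 0 := congrArg MulOpposite.unop (exists_antipode.choose_spec.2.2 0)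
theorem S_mul (a b : H1) : S (a * b) = S b * S a :=
  congrArg MulOpposite.unop (map_mul antipodeHom a b)
theorem S_one : S 1 = 1 := congrArg MulOpposite.unop (map_one antipodeHom)
theorem S_algebraMap (c : ℂ) : S (algebraMap ℂ H1 c) = algebraMap ℂ H1 c :=
  congrArg MulOpposite.unop (AlgHom.commutes antipodeHom c)

/-- A property closed under the algebra operations and true of `X`, `Y`, `δ₁` is true on `𝓗₁`. -/
theorem mem_of_generators (B : Subalgebra ℂ H1) (hX : X ∈ B) (hY : Y ∈ B) (hδ : δ 0 ∈ B)
    (h : H1) : h ∈ B := by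
  have hδ' : ∀ n, δ n ∈ B := by
    intro n
    induction n with
    | zero => exact hδ
    | succ n ih =>
      rw [← X_δ]
      exact B.sub_mem (B.mul_mem hX ih) (B.mul_mem ih hX)
  obtain ⟨f, fX, fY, fδ⟩ := exists_lift (A := B) ⟨X, hX⟩ ⟨Y, hY⟩ (fun n => ⟨δ n, hδ' n⟩)
    (Subtype.ext Y_X) (fun n => Subtype.ext (X_δ n)) (fun n => Subtype.ext (Y_δ n))
    (fun k l => Subtype.ext (δ_δ k l))
  have e : B.val.comp f = AlgHom.id ℂ H1 := by
    apply hom_ext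
    · exact congrArg Subtype.val fX
    · exact congrArg Subtype.val fY
    · exact congrArg Subtype.val (fδ 0)
  have e' : (f h : H1) = h := AlgHom.congr_fun e h
  rw [← e']
  exact (f h).2

theorem antipode_left (h : H1) :
    LinearMap.mul' ℂ H1 (S.rTensor H1 (comulHom h)) = algebraMap ℂ H1 (counitHom h) := by
  let Ψ : H1 → H1 ⊗[ℂ] H1 →ₗ[ℂ] H1 := fun c =>
    LinearMap.mul' ℂ H1 ∘ₗ ((LinearMap.mulRight ℂ c) ∘ₗ S).rTensor H1
  have key : ∀ s t : H1 ⊗[ℂ] H1, LinearMap.mul' ℂ H1 (S.rTensor H1 (s * t)) =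
      Ψ (LinearMap.mul' ℂ H1 (S.rTensor H1 s)) t := by
    intro s t
    induction t using TensorProduct.induction_on with
    | zero => simp
    | add a b ha hb => rw [mul_add, map_add, map_add, ha, hb, map_add]
    | tmul a b =>
      induction s using TensorProduct.induction_on with
      | zero => simp [Ψ]
      | add c d hc hd => rw [add_mul, map_add, map_add, hc, hd]; simp [Ψ, mul_add, add_mul]
      | tmul c d => simp [Ψ, S_mul, mul_assoc]
  let B : Subalgebra ℂ H1 :=
    { carrier := {h | LinearMap.mul' ℂ H1 (S.rTensor H1 (comulHom h)) =
        algebraMap ℂ H1 (counitHom h)}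
      algebraMap_mem' := fun c => by
        simp [Algebra.TensorProduct.algebraMap_apply, S_algebraMap]
      add_mem' := fun {a b} ha hb => by
        simp only [Set.mem_ofPred_eq, map_add] at *
        rw [ha, hb]
      mul_mem' := fun {a b} ha hb => by
        simp only [Set.mem_ofPred_eq, map_mul] at *
        rw [key, ha, ← hb]
        generalize comulHom b = t
        induction t using TensorProduct.induction_on with
        | zero => simp
        | add a b ha hb => rw [map_add, map_add, map_add, ha, hb, mul_add]
        | tmul a b =>
          simp only [Ψ, LinearMap.comp_apply, LinearMap.rTensor_tmul, LinearMap.mulRight_apply,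
            LinearMap.mul'_apply]
          rw [← Algebra.commutes, mul_assoc] }
  refine mem_of_generators B ?_ ?_ ?_ h
  · change LinearMap.mul' ℂ H1 (S.rTensor H1 (comulHom X)) = algebraMap ℂ H1 (counitHom X)
    simp [comulHom_X, counitHom_X, S_X, S_one, S_δ]
  · change LinearMap.mul' ℂ H1 (S.rTensor H1 (comulHom Y)) = algebraMap ℂ H1 (counitHom Y)
    simp [comulHom_Y, counitHom_Y, S_Y, S_one]
  · change LinearMap.mul' ℂ H1 (S.rTensor H1 (comulHom (δ 0))) =
      algebraMap ℂ H1 (counitHom (δ 0))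
    simp [comulHom_δ, counitHom_δ, S_one, S_δ]

theorem antipode_right (h : H1) :
    LinearMap.mul' ℂ H1 (S.lTensor H1 (comulHom h)) = algebraMap ℂ H1 (counitHom h) := by
  let Ψ : H1 → H1 ⊗[ℂ] H1 →ₗ[ℂ] H1 := fun c =>
    LinearMap.mul' ℂ H1 ∘ₗ ((LinearMap.mulLeft ℂ c) ∘ₗ S).lTensor H1
  have key : ∀ s t : H1 ⊗[ℂ] H1, LinearMap.mul' ℂ H1 (S.lTensor H1 (s * t)) =
      Ψ (LinearMap.mul' ℂ H1 (S.lTensor H1 t)) s := by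
    intro s t
    induction s using TensorProduct.induction_on with
    | zero => simp
    | add a b ha hb => rw [add_mul, map_add, map_add, ha, hb, map_add]
    | tmul a b =>
      induction t using TensorProduct.induction_on with
      | zero => simp [Ψ]
      | add c d hc hd => rw [mul_add, map_add, map_add, hc, hd]; simp [Ψ, mul_add, add_mul]
      | tmul c d => simp [Ψ, S_mul, mul_assoc]
  let B : Subalgebra ℂ H1 :=
    { carrier := {h | LinearMap.mul' ℂ H1 (S.lTensor H1 (comulHom h)) =
        algebraMap ℂ H1 (counitHom h)}
      algebraMap_mem' := fun c => by
        simp [Algebra.TensorProduct.algebraMap_apply, S_one]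
      add_mem' := fun {a b} ha hb => by
        simp only [Set.mem_ofPred_eq, map_add] at *
        rw [ha, hb]
      mul_mem' := fun {a b} ha hb => by
        simp only [Set.mem_ofPred_eq, map_mul] at *
        rw [key, hb, ← ha]
        generalize comulHom a = t
        induction t using TensorProduct.induction_on with
        | zero => simp
        | add a b ha hb => rw [map_add, map_add, map_add, ha, hb, add_mul]
        | tmul a b =>
          simp only [Ψ, LinearMap.comp_apply, LinearMap.lTensor_tmul, LinearMap.mulLeft_apply,
            LinearMap.mul'_apply]
          rw [Algebra.commutes, mul_assoc] }
  refine mem_of_generators B ?_ ?_ ?_ h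
  · change LinearMap.mul' ℂ H1 (S.lTensor H1 (comulHom X)) = algebraMap ℂ H1 (counitHom X)
    simp [comulHom_X, counitHom_X, S_X, S_one, S_Y]
  · change LinearMap.mul' ℂ H1 (S.lTensor H1 (comulHom Y)) = algebraMap ℂ H1 (counitHom Y)
    simp [comulHom_Y, counitHom_Y, S_Y, S_one]
  · change LinearMap.mul' ℂ H1 (S.lTensor H1 (comulHom (δ 0))) =
      algebraMap ℂ H1 (counitHom (δ 0))
    simp [comulHom_δ, counitHom_δ, S_one, S_δ]

instance : HopfAlgebra ℂ H1 where
  antipode := S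
  mul_antipode_rTensor_comul := LinearMap.ext antipode_left
  mul_antipode_lTensor_comul := LinearMap.ext antipode_right

end Hopf

end Construction

end H1
section QuasimodularHeckeOperators

open UpperHalfPlane hiding I
open Complex (I)
open CongruenceSubgroup


/-- The tower of modular forms of weight `k`: the functions on `ℍ` that are modular forms
of weight `k` for some principal congruence subgroup `Γ(N)`, `N ≥ 1`. -/
def modularTower (k : ℕ) : Submodule ℂ (ℍ → ℂ) where
  carrier := {f | ∃ N : ℕ, 0 < N ∧
    ∃ g : ModularForm ((Gamma N).map (Matrix.SpecialLinearGroup.mapGL ℝ)) (k : ℤ), ⇑g = f}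
  zero_mem' := ⟨1, one_pos, 0, rfl⟩
  add_mem' := by
    have key : ∀ (N M : ℕ), 0 < N → 0 < M → N ∣ M →
        ∀ g : ModularForm ((Gamma N).map (Matrix.SpecialLinearGroup.mapGL ℝ)) (k : ℤ),
        ∃ g' : ModularForm ((Gamma M).map (Matrix.SpecialLinearGroup.mapGL ℝ)) (k : ℤ),
          (⇑g' : ℍ → ℂ) = ⇑g := by
      intro N M hN hM hNM g
      have : NeZero N := ⟨hN.ne'⟩
      have : NeZero M := ⟨hM.ne'⟩
      refine ⟨{ toFun := g
                slash_action_eq' := ?_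
                holo' := g.holo'
                bdd_at_cusps' := ?_ }, rfl⟩
      · rintro A ⟨B, hB, rfl⟩
        refine g.slash_action_eq' _ ⟨B, ?_, rfl⟩
        rw [SetLike.mem_coe, Gamma_mem] at hB ⊢
        obtain ⟨h1, h2, h3, h4⟩ := hB
        have cast : ∀ a b : ℤ, (a : ZMod M) = (b : ZMod M) → (a : ZMod N) = (b : ZMod N) := by
          intro a b h
          rw [ZMod.intCast_eq_intCast_iff_dvd_sub] at h ⊢
          exact (Int.natCast_dvd_natCast.mpr hNM).trans h
        refine ⟨?_, ?_, ?_, ?_⟩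
        · simpa using cast _ 1 (by simpa using h1)
        · simpa using cast _ 0 (by simpa using h2)
        · simpa using cast _ 0 (by simpa using h3)
        · simpa using cast _ 1 (by simpa using h4)
      · intro c hc
        refine g.bdd_at_cusps' ?_
        rw [Subgroup.IsArithmetic.isCusp_iff_isCusp_SL2Z] at hc ⊢
        exact hc
    rintro _ _ ⟨N, hN, f, rfl⟩ ⟨M, hM, g, rfl⟩
    obtain ⟨f', hf⟩ := key N (N * M) hN (Nat.mul_pos hN hM) (Dvd.intro _ rfl) f
    obtain ⟨g', hg⟩ := key M (N * M) hM (Nat.mul_pos hN hM) (Dvd.intro_left _ rfl) g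
    exact ⟨N * M, Nat.mul_pos hN hM, f' + g', by rw [← hf, ← hg]; rfl⟩
  smul_mem' := by
    rintro c _ ⟨N, hN, f, rfl⟩
    exact ⟨N, hN, c • f, rfl⟩

theorem mdiff_of_mem_modularTower {k : ℕ} {f : ℍ → ℂ} (hf : f ∈ modularTower k) : MDiff f := by
  obtain ⟨N, _, g, rfl⟩ := hf
  exact g.holo'

/-- `f` is a quasimodular form of level `N`, weight `k` and depth `s`; the last clause is the
usual holomorphy (boundedness) condition at all cusps. -/
def IsQuasimodularForm (N k s : ℕ) (f : ℍ → ℂ) : Prop :=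
  (f = 0 ∧ s = 0) ∨
  (MDiff f ∧ ∃ g : ℕ → ℍ → ℂ,
    (∀ j ≤ s, MDiff (g j)) ∧ g s ≠ 0 ∧
    (∀ γ ∈ Gamma N, ∀ z : ℍ,
      (denom γ z) ^ (-(k : ℤ)) * f (γ • z) =
        ∑ j ∈ Finset.range (s + 1), g j z * (((γ 1 0 : ℤ) : ℂ) / denom γ z) ^ j) ∧
    (∀ j ≤ s, ∀ α : SL(2, ℤ), IsBoundedAtImInfty (g j ∣[((k : ℤ) - 2 * j)] α)))

/-- The quasimodular tower, spanned by the quasimodular forms of all levels, weights, depths. -/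
def QM : Submodule ℂ (ℍ → ℂ) :=
  Submodule.span ℂ {f | ∃ N k s : ℕ, 0 < N ∧ IsQuasimodularForm N k s f}

/-- The classical Eisenstein series `G₂ = -B₂/4 + ∑_{n ≥ 1} σ₁(n) qⁿ`. -/
def eisG2 (z : ℍ) : ℂ :=
  -((bernoulli 2 : ℚ) : ℂ) / (2 * 2) +
    ∑' n : ℕ, (ArithmeticFunction.sigma 1 (n + 1) : ℂ) *
      Complex.exp (2 * Real.pi * I * ((n + 1 : ℕ) : ℂ) * (z : ℂ))

/-- The modular form `Δ(z) = (2π)¹² q ∏ (1 - qⁿ)²⁴` of weight `12`. -/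
def bigDelta (z : ℍ) : ℂ := (2 * Real.pi) ^ 12 * ModularForm.discriminant z

/-- Inclusion of `GL₂⁺(ℚ)` in `GL₂(ℝ)`. -/
def toRealGL (α : GL(2, ℚ)⁺) : GL (Fin 2) ℝ :=
  Matrix.GeneralLinearGroup.map (Rat.castHom ℝ) (α : GL (Fin 2) ℚ)

/-- The slash action of `GL₂⁺(ℚ)` in weight `k`, normalised by `det(α)^{k/2}`:
`(f|_k α)(z) = det(α)^{k/2} (cz+d)^{-k} f((az+b)/(cz+d))`. -/
def slash (k : ℕ) (α : GL(2, ℚ)⁺) : (ℍ → ℂ) →ₗ[ℂ] (ℍ → ℂ) where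
  toFun f z := ((((toRealGL α).det : ℝ) ^ ((k : ℝ) / 2) : ℝ) : ℂ) *
    (denom (toRealGL α) z) ^ (-(k : ℤ)) * f (toRealGL α • z)
  map_add' f g := by ext z; simp only [Pi.add_apply]; ring
  map_smul' c f := by ext z; simp only [Pi.smul_apply, smul_eq_mul, RingHom.id_apply]; ring

/-- `μ_δ = (1/12πi) d/dz log (Δ|δ / Δ)`. -/
def mu (δ : GL(2, ℚ)⁺) (z : ℍ) : ℂ :=
  (1 / (12 * Real.pi * I)) *
    logDeriv ((fun w : ℍ => slash 12 δ bigDelta w / bigDelta w) ∘ ofComplex) z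

/-- The weight operator `Y(f) = (k/2) f` on modular forms of weight `k`. -/
def modY (k : ℕ) : modularTower k →ₗ[ℂ] (ℍ → ℂ) := ((k : ℂ) / 2) • (modularTower k).subtype

/-- The Ramanujan operator `X(f) = (1/2πi) f' - (1/12πi) (log Δ)' Y(f)` on modular forms of
weight `k`. -/
def modX (k : ℕ) : modularTower k →ₗ[ℂ] (ℍ → ℂ) where
  toFun f z := (1 / (2 * Real.pi * I)) * deriv ((f : ℍ → ℂ) ∘ ofComplex) z -
    (1 / (12 * Real.pi * I)) * logDeriv (bigDelta ∘ ofComplex) z * modY k f z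
  map_add' f g := by
    ext z
    have h := congrFun (Derivative.normalizedDerivOfComplex_add _ _
      (mdiff_of_mem_modularTower f.2) (mdiff_of_mem_modularTower g.2)) z
    simp only [Derivative.normalizedDerivOfComplex, Pi.add_apply, inv_eq_one_div] at h
    simp only [map_add, Pi.add_apply, Submodule.coe_add]
    rw [h]; ring
  map_smul' c f := by
    ext z
    have h := congrFun (Derivative.normalizedDerivOfComplex_smul c _
      (mdiff_of_mem_modularTower f.2)) z
    simp only [Derivative.normalizedDerivOfComplex, Pi.smul_apply, smul_eq_mul,
      inv_eq_one_div] at h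
    simp only [map_smul, Pi.smul_apply, Submodule.coe_smul, smul_eq_mul, RingHom.id_apply]
    rw [h]; ring

/-- Families `(a_{i,k})` with `a_{i,k}` a modular form of weight `k` (of some level), all but
finitely many zero: the coefficients of a polynomial in `G₂` over the modular tower. -/
abbrev Coeffs : Type := ⨁ p : ℕ × ℕ, modularTower p.2

/-- `(a_{i,k}) ↦ ∑ T_k(a_{i,k}) G₂^i`. -/
def evalWith (T : ∀ k, modularTower k →ₗ[ℂ] (ℍ → ℂ)) : Coeffs →ₗ[ℂ] (ℍ → ℂ) :=
  DirectSum.toModule ℂ (ℕ × ℕ) (ℍ → ℂ)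
    fun p => (LinearMap.mulRight ℂ (eisG2 ^ p.1)).comp (T p.2)

/-- The `G₂`-expansion of a quasimodular form: `coeffs f` is the unique family `(a_{i,k})` of
modular forms with `f = ∑ a_{i,k} G₂^i` (the value is only meaningful on the quasimodular
tower, which is the range of the evaluation map `(a_{i,k}) ↦ ∑ a_{i,k} G₂^i`). -/
def coeffs : (ℍ → ℂ) →ₗ[ℂ] Coeffs :=
  LinearMap.leftInverse (K := ℂ) (V := Coeffs) (V' := ℍ → ℂ)
    (evalWith fun k => (modularTower k).subtype)

/-- The operator `∑ a_{i,k} G₂^i ↦ ∑ T_k(a_{i,k}) G₂^i` on the quasimodular tower. -/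
def extend (T : ∀ k, modularTower k →ₗ[ℂ] (ℍ → ℂ)) : (ℍ → ℂ) →ₗ[ℂ] (ℍ → ℂ) :=
  (evalWith T).comp coeffs

/-- `f || α = ∑ (a_i(f)|α) G₂^i`. -/
def qslash (α : GL(2, ℚ)⁺) : (ℍ → ℂ) →ₗ[ℂ] (ℍ → ℂ) :=
  extend fun k => (slash k α).comp (modularTower k).subtype

/-- `X(f) = ∑ X(a_i(f)) G₂^i`. -/
def opX : (ℍ → ℂ) →ₗ[ℂ] (ℍ → ℂ) := extend modX

/-- `Y(f) = ∑ Y(a_i(f)) G₂^i`. -/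
def opY : (ℍ → ℂ) →ₗ[ℂ] (ℍ → ℂ) := extend modY

/-- Inclusion of `SL₂(ℤ)` in `GL₂⁺(ℚ)`. -/
def toGLQ : SL(2, ℤ) →* GL(2, ℚ)⁺ :=
  Matrix.SpecialLinearGroup.toGLPos.comp (Matrix.SpecialLinearGroup.map (Int.castRingHom ℚ))

/-- `Γ(N)` as a subgroup of `GL₂⁺(ℚ)`. -/
def GammaQ (N : ℕ) : Subgroup GL(2, ℚ)⁺ := (Gamma N).map toGLQ

/-- The coset space `Γ(N) \ GL₂⁺(ℚ)`. -/
abbrev Cosets (N : ℕ) : Type := Quotient (QuotientGroup.rightRel (GammaQ N))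

/-- The space `𝒬_σ(Γ(N))` of `σ`-twisted quasimodular Hecke operators of level `Γ(N)`:
functions `α ↦ F_α` from `GL₂⁺(ℚ)` to the quasimodular tower that are left `Γ(N)`-invariant,
supported on finitely many cosets in `Γ(N) \ GL₂⁺(ℚ)`, and satisfy
`F_{αγ} = F_α || σγσ⁻¹` for `γ ∈ Γ(N)`. For `σ = 1` this is `𝒬(Γ(N))`. -/
def Q (N : ℕ) (σ : SL(2, ℤ)) : Submodule ℂ (GL(2, ℚ)⁺ → ℍ → ℂ) where
  carrier := {F | (∀ α, F α ∈ QM) ∧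
    (∀ γ ∈ Gamma N, ∀ α, F (toGLQ γ * α) = F α) ∧
    ((fun α => (Quotient.mk _ α : Cosets N)) '' Function.support F).Finite ∧
    (∀ γ ∈ Gamma N, ∀ α, F (α * toGLQ γ) = qslash (toGLQ (σ * γ * σ⁻¹)) (F α))}
  zero_mem' := by
    refine ⟨fun _ => QM.zero_mem, fun _ _ _ => rfl, ?_, fun _ _ _ => ?_⟩
    · simp
    · simp
  add_mem' := by
    rintro F G ⟨h1, h2, h3, h4⟩ ⟨k1, k2, k3, k4⟩
    refine ⟨fun α => QM.add_mem (h1 α) (k1 α), fun γ hγ α => ?_, ?_, fun γ hγ α => ?_⟩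
    · simp only [Pi.add_apply, h2 γ hγ, k2 γ hγ]
    · refine (h3.union k3).subset ?_
      rw [← Set.image_union]
      exact Set.image_mono (Function.support_add F G)
    · simp only [Pi.add_apply, h4 γ hγ, k4 γ hγ, map_add]
  smul_mem' := by
    rintro c F ⟨h1, h2, h3, h4⟩
    refine ⟨fun α => QM.smul_mem c (h1 α), fun γ hγ α => ?_, ?_, fun γ hγ α => ?_⟩
    · simp only [Pi.smul_apply, h2 γ hγ]
    · exact h3.subset (Set.image_mono (Function.support_const_smul_subset c F))
    · simp only [Pi.smul_apply, h4 γ hγ, map_smul]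

/-- `(F¹ ∗ F²)_α = ∑_{β ∈ Γ(N) \ GL₂⁺(ℚ)} F¹_{βσ} · (F²_{ασ⁻¹β⁻¹} || β)`. -/
def heckeMul (N : ℕ) (σ : SL(2, ℤ)) (F G : GL(2, ℚ)⁺ → ℍ → ℂ) (α : GL(2, ℚ)⁺) : ℍ → ℂ :=
  ∑ᶠ c : Cosets N, F (c.out * toGLQ σ) * qslash c.out (G (α * (toGLQ σ)⁻¹ * c.out⁻¹))

end QuasimodularHeckeOperators

end QMHecke

end

/-!
For fixed `z`, a polynomial relation between `cz + d` and `c`, valid for all `(a b; c d)` in a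
congruence subgroup, is trivial. Applied to the transformation law of `G₂` this gives uniqueness of
`G₂`-expansions. For existence, let `f` transform by `P_z(t) = ∑ fⱼ(z) tʲ`, evaluated at
`t = c / (cz + d)`, and let `G` be `G₂` scaled so that `(G|γ)(z) = G(z) + c / (cz + d)`. The Taylor
coefficients of `P_z` at `-G(z)` are modular forms, and `f(z) = P_z(0)` is a polynomial in `G` with
these coefficients. Hence `||α`, `X` and `Y` can be computed on the monomials `a G₂ⁱ`.

The logarithmic derivative of `Δ` makes `μ` a cocycle, `μ_{αβ} = μ_α || β + μ_β`, vanishing on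
`SL₂(ℤ)`, and makes `X` commute with `||α` up to `μ_α`: `X (f || α) = X f || α + μ_α * Y (f || α)`.
The error term is exactly what the summand `δ₁ ⊗ Y` of `Δ(X)` accounts for. Since the elements `h`
satisfying the Hopf identity form a subalgebra, it is enough to verify it for `X`, `Y` and `δ₁`,
and there it holds term by term in the sum over cosets.
-/

noncomputable section

namespace QMHecke

open UpperHalfPlane hiding I
open Complex (I)
open CongruenceSubgroup

/-! ### The slash action of `GL₂⁺(ℚ)` -/

theorem det_toRealGL_pos (α : GL(2, ℚ)⁺) : 0 < ((toRealGL α).det : ℝ) := by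
  have hα : (0 : ℚ) < (α : GL (Fin 2) ℚ).det.val := α.2
  have hdet : ((toRealGL α).det : ℝ) = (((α : GL (Fin 2) ℚ).det.val : ℚ) : ℝ) := by
    simp [toRealGL, Matrix.det_fin_two]
  rw [hdet]
  exact_mod_cast hα

theorem toRealGL_mul (α β : GL(2, ℚ)⁺) : toRealGL (α * β) = toRealGL α * toRealGL β := by
  simp [toRealGL]

theorem toRealGL_toGLQ (γ : SL(2, ℤ)) : toRealGL (toGLQ γ) = γ := by
  ext i j
  simp [toRealGL, toGLQ]

theorem σ_of_det_pos {g : GL (Fin 2) ℝ} (hg : 0 < g.det.val) (x : ℂ) : σ g x = x := by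
  rw [σ, if_pos hg]
  rfl

/-- Mathlib normalises the weight `k` slash action by `det ^ (k - 1)`. -/
theorem slash_eq_smul (k : ℕ) (α : GL(2, ℚ)⁺) (f : ℍ → ℂ) :
    slash k α f = (((((toRealGL α).det : ℝ) ^ (1 - (k : ℝ) / 2) : ℝ)) : ℂ) •
      (f ∣[(k : ℤ)] toRealGL α) := by
  have hdet := det_toRealGL_pos α
  have hpow : (((toRealGL α).det : ℝ) ^ ((k : ℝ) / 2)) =
      ((toRealGL α).det : ℝ) ^ (1 - (k : ℝ) / 2) * ((toRealGL α).det : ℝ) ^ ((k : ℤ) - 1) := by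
    rw [← Real.rpow_intCast, ← Real.rpow_add hdet]
    congr 1
    push_cast
    ring
  ext z
  simp only [slash, LinearMap.coe_mk, AddHom.coe_mk, Pi.smul_apply, smul_eq_mul,
    ModularForm.slash_apply, σ_of_det_pos hdet, abs_of_pos hdet, hpow]
  push_cast
  ring

theorem slash_two (α : GL(2, ℚ)⁺) (f : ℍ → ℂ) : slash 2 α f = f ∣[(2 : ℤ)] toRealGL α := by
  simp [slash_eq_smul]

theorem slash_toGLQ (k : ℕ) (γ : SL(2, ℤ)) (f : ℍ → ℂ) :
    slash k (toGLQ γ) f = f ∣[(k : ℤ)] γ := by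
  simp [slash_eq_smul, toRealGL_toGLQ, ModularForm.SL_slash]

theorem slash_one (k : ℕ) (f : ℍ → ℂ) : slash k 1 f = f := by
  simpa using slash_toGLQ k 1 f

theorem slash_slash (k : ℕ) (α β : GL(2, ℚ)⁺) (f : ℍ → ℂ) :
    slash k β (slash k α f) = slash k (α * β) f := by
  simp only [slash_eq_smul, ModularForm.smul_slash, σ_of_det_pos (det_toRealGL_pos β),
    toRealGL_mul, SlashAction.slash_mul, smul_smul, map_mul, Units.val_mul]
  rw [Real.mul_rpow (det_toRealGL_pos α).le (det_toRealGL_pos β).le, mul_comm, Complex.ofReal_mul]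

theorem slash_mul (k l : ℕ) (α : GL(2, ℚ)⁺) (f g : ℍ → ℂ) :
    slash (k + l) α (f * g) = slash k α f * slash l α g := by
  ext z
  simp only [slash, LinearMap.coe_mk, AddHom.coe_mk, Pi.mul_apply, Nat.cast_add, add_div, neg_add,
    Real.rpow_add (det_toRealGL_pos α), zpow_add₀ (denom_ne_zero _ z), Complex.ofReal_mul]
  ring

/-! ### The modular tower -/

theorem Gamma_le_of_dvd {N M : ℕ} (h : N ∣ M) : Gamma M ≤ Gamma N := by
  intro γ hγ
  have hfactor : Matrix.SpecialLinearGroup.map (Int.castRingHom (ZMod N)) γ =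
      Matrix.SpecialLinearGroup.map (ZMod.castHom h (ZMod N))
        (Matrix.SpecialLinearGroup.map (Int.castRingHom (ZMod M)) γ) := by
    ext i j
    simp
  rw [Gamma_mem'] at hγ ⊢
  rw [hfactor, hγ, map_one]

theorem exists_modularForm_coe_eq {N : ℕ} (hN : 0 < N) {k : ℤ} {f : ℍ → ℂ} (hf : MDiff f)
    (hslash : ∀ γ ∈ Gamma N, f ∣[k] γ = f)
    (hbdd : ∀ α : SL(2, ℤ), IsBoundedAtImInfty (f ∣[k] α)) :
    ∃ F : ModularForm ((Gamma N).map (Matrix.SpecialLinearGroup.mapGL ℝ)) k, ⇑F = f := by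
  have : NeZero N := ⟨hN.ne'⟩
  refine ⟨⟨⟨f, ?_⟩, hf, fun {c} hc => ?_⟩, rfl⟩
  · rintro _ ⟨γ, hγ, rfl⟩
    exact hslash γ hγ
  · rw [Subgroup.IsArithmetic.isCusp_iff_isCusp_SL2Z] at hc
    exact (OnePoint.isBoundedAt_iff_forall_SL2Z hc).mpr fun γ _ => hbdd γ

theorem mem_modularTower_iff {k : ℕ} {f : ℍ → ℂ} :
    f ∈ modularTower k ↔ MDiff f ∧ (∃ N : ℕ, 0 < N ∧ ∀ γ ∈ Gamma N, f ∣[(k : ℤ)] γ = f) ∧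
      ∀ α : SL(2, ℤ), IsBoundedAtImInfty (f ∣[(k : ℤ)] α) := by
  constructor
  · rintro ⟨N, hN, g, rfl⟩
    have : NeZero N := ⟨hN.ne'⟩
    exact ⟨g.holo', ⟨N, hN, fun γ hγ => g.slash_action_eq' _ ⟨γ, hγ, rfl⟩⟩,
      fun α => ModularFormClass.bdd_at_infty_slash g α⟩
  · rintro ⟨hf, ⟨N, hN, hslash⟩, hbdd⟩
    obtain ⟨F, hF⟩ := exists_modularForm_coe_eq hN hf hslash hbdd
    exact ⟨N, hN, F, hF⟩

theorem mul_mem_modularTower {k l : ℕ} {f g : ℍ → ℂ} (hf : f ∈ modularTower k)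
    (hg : g ∈ modularTower l) : f * g ∈ modularTower (k + l) := by
  rw [mem_modularTower_iff] at hf hg ⊢
  obtain ⟨hf, ⟨N, hN, hfN⟩, hf_bdd⟩ := hf
  obtain ⟨hg, ⟨M, hM, hgM⟩, hg_bdd⟩ := hg
  simp only [Nat.cast_add, ModularForm.mul_slash_SL2]
  refine ⟨hf.mul hg, ⟨N * M, Nat.mul_pos hN hM, fun γ hγ => ?_⟩,
    fun α => (hf_bdd α).mul (hg_bdd α)⟩
  rw [hfN γ (Gamma_le_of_dvd (Nat.dvd_mul_right N M) hγ),
    hgM γ (Gamma_le_of_dvd (Nat.dvd_mul_left M N) hγ)]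

theorem exists_isCoprime_mul_add_mul_eq_zero (a c : ℚ) :
    ∃ p q : ℤ, IsCoprime p q ∧ (p : ℚ) * a + q * c = 0 := by
  by_cases hc : c = 0
  · exact ⟨0, 1, isCoprime_zero_left.mpr isUnit_one, by simp [hc]⟩
  · refine ⟨(a / c).den, -(a / c).num, ?_, ?_⟩
    · rw [IsCoprime.neg_right_iff, Int.isCoprime_iff_gcd_eq_one, Int.gcd_comm]
      exact (a / c).reduced
    · have hden : ((a / c).den : ℚ) ≠ 0 := by simp
      have hac : ((a / c).num : ℚ) / (a / c).den = a / c := Rat.num_div_den _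
      rw [div_eq_div_iff hden hc] at hac
      push_cast
      linear_combination -hac

theorem exists_eq_toGLQ_mul_upperTriangular (α : GL(2, ℚ)⁺) :
    ∃ (γ : SL(2, ℤ)) (β : GL(2, ℚ)⁺), α = toGLQ γ * β ∧ (toRealGL β) 1 0 = 0 := by
  obtain ⟨p, q, hpq, hzero⟩ := exists_isCoprime_mul_add_mul_eq_zero
    ((α : GL (Fin 2) ℚ) 0 0) ((α : GL (Fin 2) ℚ) 1 0)
  obtain ⟨γ, rfl, rfl⟩ := hpq.exists_SL2_row 1
  refine ⟨γ⁻¹, toGLQ γ * α, by rw [map_inv, inv_mul_cancel_left], ?_⟩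
  have hentry : (toRealGL (toGLQ γ * α)) 1 0 = ((((γ 1 0 : ℤ) : ℚ) * (α : GL (Fin 2) ℚ) 0 0 +
      ((γ 1 1 : ℤ) : ℚ) * (α : GL (Fin 2) ℚ) 1 0 : ℚ) : ℝ) := by
    simp [toRealGL, toGLQ, Matrix.mul_apply, Fin.sum_univ_two]
  rw [hentry, hzero, Rat.cast_zero]

theorem exists_Gamma_conj (α : GL(2, ℚ)⁺) {M : ℕ} (hM : 0 < M) :
    ∃ N : ℕ, 0 < N ∧ ∀ x ∈ Gamma N, ∃ y ∈ Gamma M, α * toGLQ x = toGLQ y * α := by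
  have : NeZero M := ⟨hM.ne'⟩
  have hcoe (w : SL(2, ℤ)) : ((toGLQ w : GL(2, ℚ)⁺) : GL (Fin 2) ℚ) =
      Matrix.SpecialLinearGroup.mapGL ℚ w := by
    ext i j
    simp [toGLQ]
  obtain ⟨N, hN, hconj⟩ := exists_Gamma_le_conj (α : GL (Fin 2) ℚ) M
  refine ⟨N, Nat.pos_of_ne_zero hN, fun x hx => ?_⟩
  obtain ⟨y, hy, hxy⟩ := hconj x hx
  refine ⟨y, hy, Subtype.ext ?_⟩
  rw [Subgroup.coe_mul, Subgroup.coe_mul, hcoe, hcoe, hxy, inv_mul_cancel_right]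

theorem slash_mem_modularTower {k : ℕ} {f : ℍ → ℂ} (α : GL(2, ℚ)⁺) (hf : f ∈ modularTower k) :
    slash k α f ∈ modularTower k := by
  rw [mem_modularTower_iff] at hf ⊢
  obtain ⟨hf, ⟨N, hN, hfN⟩, hbdd⟩ := hf
  refine ⟨?_, ?_, fun γ => ?_⟩
  · rw [slash_eq_smul]
    exact (hf.slash _ _).const_smul _
  · obtain ⟨M, hM, hconj⟩ := exists_Gamma_conj α hN
    refine ⟨M, hM, fun x hx => ?_⟩
    obtain ⟨y, hy, hxy⟩ := hconj x hx
    rw [← slash_toGLQ, slash_slash, hxy, ← slash_slash, slash_toGLQ, hfN y hy]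
  · obtain ⟨γ', β, hαγ, hβ⟩ := exists_eq_toGLQ_mul_upperTriangular (α * toGLQ γ)
    rw [← slash_toGLQ, slash_slash, hαγ, ← slash_slash, slash_toGLQ, slash_eq_smul]
    exact ((hbdd γ').slash _ hβ).const_smul_left _

/-! ### Derivatives and the cocycle `μ` -/

section Derivation

open Derivative

/-- The function `κ_g(z) = c / (c z + d)`, which measures both the failure of the derivative of
a modular form and the failure of `E₂` to be modular. -/
def kappa (g : GL (Fin 2) ℝ) (z : ℍ) : ℂ := (g 1 0 : ℂ) / denom g z

theorem kappa_mul_apply (g h : GL (Fin 2) ℝ) (hh : 0 < h.det.val) (z : ℍ) :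
    kappa (g * h) z = h.det.val / (denom h z) ^ 2 * kappa g (h • z) + kappa h z := by
  have hden_h := denom_ne_zero h z
  have hden_g := denom_ne_zero g (h • z)
  have key : ((g * h) 1 0 : ℂ) * denom h z = h.det.val * g 1 0 + h 1 0 * denom (g * h) z := by
    simp only [denom, Matrix.GeneralLinearGroup.val_det_apply, Matrix.det_fin_two, Units.val_mul,
      Matrix.mul_apply, Fin.sum_univ_two]
    push_cast
    ring
  have hden : denom (g * h) z = denom g (h • z : ℍ) * denom h z := by
    rw [denom_cocycle_σ, σ_of_det_pos hh]
  rw [hden] at key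
  simp only [kappa, hden]
  field_simp
  linear_combination key

theorem kappa_mul (g h : GL (Fin 2) ℝ) (hh : 0 < h.det.val) :
    kappa (g * h) = kappa g ∣[(2 : ℤ)] h + kappa h := by
  ext z
  have hden := denom_ne_zero h z
  rw [kappa_mul_apply g h hh, Pi.add_apply, ModularForm.slash_apply, σ_of_det_pos hh,
    abs_of_pos hh]
  norm_num [zpow_neg]
  field_simp

theorem kappa_eq_zero {g : GL (Fin 2) ℝ} (hg : g 1 0 = 0) : kappa g = 0 := by
  ext z
  simp [kappa, hg]

theorem mdiff_kappa (g : GL (Fin 2) ℝ) : MDiff (kappa g) := by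
  have hzpow : kappa g = (g 1 0 : ℂ) • fun z : ℍ => denom g z ^ (-1 : ℤ) := by
    ext z
    simp [kappa, div_eq_mul_inv]
  rw [hzpow]
  exact (mdifferentiable_denom_zpow g (-1)).const_smul _

theorem E2_slash_SL (γ : SL(2, ℤ)) : EisensteinSeries.E2 ∣[(2 : ℤ)] γ =
    EisensteinSeries.E2 + (6 / (Real.pi * I) : ℂ) • kappa γ := by
  have hD2 : EisensteinSeries.D2 γ = (2 * Real.pi * I : ℂ) • kappa γ := by
    ext z
    simp [EisensteinSeries.D2, kappa, mul_div_assoc]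
  rw [EisensteinSeries.E2_slash_action, hD2, sub_eq_add_neg, smul_smul,
    ← _root_.neg_smul, riemannZeta_two]
  congr 2
  field_simp
  rw [Complex.I_sq]
  ring

theorem logDeriv_comp_ofComplex (f : ℍ → ℂ) (z : ℍ) :
    logDeriv (f ∘ ofComplex) z = 2 * Real.pi * I * (D f z / f z) := by
  rw [logDeriv_apply, Function.comp_apply, ofComplex_apply, normalizedDerivOfComplex]
  field_simp

theorem bigDelta_comp_ofComplex_eventuallyEq (z : ℍ) : bigDelta ∘ ofComplex =ᶠ[nhds (z : ℂ)]
    fun w => (2 * Real.pi) ^ 12 * ModularForm.eta w ^ 24 := by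
  filter_upwards [isOpen_upperHalfPlaneSet.mem_nhds z.im_pos] with w hw
  rw [Function.comp_apply, ofComplex_apply_of_im_pos hw]
  rfl

theorem logDeriv_bigDelta (z : ℍ) :
    logDeriv (bigDelta ∘ ofComplex) z = 2 * Real.pi * I * EisensteinSeries.E2 z := by
  have heq := bigDelta_comp_ofComplex_eventuallyEq z
  have hη := ModularForm.differentiableAt_eta_of_mem_upperHalfPlaneSet z.2
  rw [logDeriv_apply, heq.deriv_eq, heq.eq_of_nhds, ← logDeriv_apply,
    logDeriv_const_mul _ _ (by simp [Real.pi_ne_zero]), logDeriv_fun_pow hη,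
    ModularForm.logDeriv_eta_eq_E2]
  push_cast
  ring

theorem bigDelta_ne_zero (z : ℍ) : bigDelta z ≠ 0 :=
  mul_ne_zero (by simp [Real.pi_ne_zero]) (ModularForm.discriminant_ne_zero z)

theorem mdiff_bigDelta : MDiff bigDelta := by
  intro z
  rw [mdifferentiableAt_iff]
  refine DifferentiableAt.congr_of_eventuallyEq ?_ (bigDelta_comp_ofComplex_eventuallyEq z)
  exact ((ModularForm.differentiableAt_eta_of_mem_upperHalfPlaneSet z.2).pow 24).const_mul _

theorem D_bigDelta : D bigDelta = EisensteinSeries.E2 * bigDelta := by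
  ext z
  have hlog := (logDeriv_comp_ofComplex bigDelta z).symm.trans (logDeriv_bigDelta z)
  rwa [mul_right_inj' Complex.two_pi_I_ne_zero, div_eq_iff (bigDelta_ne_zero z)] at hlog

theorem modX_eq_serreDerivative (k : ℕ) (f : modularTower k) :
    modX k f = serreDerivative k (f : ℍ → ℂ) := by
  ext z
  simp only [modX, LinearMap.coe_mk, AddHom.coe_mk, modY, LinearMap.smul_apply,
    Submodule.subtype_apply, Pi.smul_apply, smul_eq_mul, logDeriv_bigDelta,
    serreDerivative_apply, normalizedDerivOfComplex]
  field_simp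

theorem serreDerivative_eq_sub_smul (k : ℂ) (f : ℍ → ℂ) :
    serreDerivative k f = D f - (k / 12) • (EisensteinSeries.E2 * f) := by
  ext z
  simp only [serreDerivative_apply, Pi.sub_apply, Pi.smul_apply, Pi.mul_apply, smul_eq_mul]
  ring

theorem modX_eq_D_sub (k : ℕ) (f : modularTower k) :
    modX k f = D (f : ℍ → ℂ) - (1 / 6 : ℂ) • (EisensteinSeries.E2 * modY k f) := by
  rw [modX_eq_serreDerivative, serreDerivative_eq_sub_smul]
  ext z
  simp only [modY, Pi.sub_apply, Pi.smul_apply, Pi.mul_apply, LinearMap.smul_apply, smul_eq_mul,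
    Submodule.subtype_apply]
  ring

theorem D_slash (k : ℕ) (α : GL(2, ℚ)⁺) {f : ℍ → ℂ} (hf : MDiff f) :
    D (slash k α f) = slash (k + 2) α (D f) -
      ((k : ℂ) / (2 * Real.pi * I)) • (kappa (toRealGL α) * slash k α f) := by
  have hdet := det_toRealGL_pos α
  have hdet' : (((toRealGL α).det : ℝ) : ℂ) ≠ 0 := by exact_mod_cast hdet.ne'
  have hpow : ((toRealGL α).det : ℝ) ^ (1 - (k : ℝ) / 2) =
      ((toRealGL α).det : ℝ) ^ (1 - ((k + 2 : ℕ) : ℝ) / 2) * ((toRealGL α).det : ℝ) := by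
    rw [← Real.rpow_add_one hdet.ne']
    congr 1
    push_cast
    ring
  rw [slash_eq_smul k, slash_eq_smul (k + 2), hpow,
    normalizedDerivOfComplex_smul _ _ (hf.slash _ _), normalizedDerivOfComplex_slash hf hdet]
  ext z
  simp only [Pi.smul_apply, Pi.sub_apply, Pi.mul_apply, smul_eq_mul, kappa]
  generalize ((toRealGL α).det : ℝ) ^ (1 - ((k + 2 : ℕ) : ℝ) / 2) = C
  simp only [Matrix.GeneralLinearGroup.val_det_apply] at hdet' ⊢
  push_cast
  field_simp

theorem slash_bigDelta_ne_zero (δ : GL(2, ℚ)⁺) (z : ℍ) : slash 12 δ bigDelta z ≠ 0 := by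
  have hdet := Real.rpow_pos_of_pos (det_toRealGL_pos δ) ((12 : ℕ) / 2)
  simp only [slash, LinearMap.coe_mk, AddHom.coe_mk]
  exact mul_ne_zero (mul_ne_zero (by exact_mod_cast hdet.ne')
    (zpow_ne_zero _ (denom_ne_zero _ _))) (bigDelta_ne_zero _)

theorem mu_eq (δ : GL(2, ℚ)⁺) : mu δ = (1 / 6 : ℂ) • (slash 2 δ EisensteinSeries.E2 -
    EisensteinSeries.E2) - (1 / (Real.pi * I) : ℂ) • kappa (toRealGL δ) := by
  ext z
  have hnum := slash_bigDelta_ne_zero δ z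
  have hden := bigDelta_ne_zero z
  have hmdiff : MDiff (slash 12 δ bigDelta) := by
    rw [slash_eq_smul]
    exact (mdiff_bigDelta.slash _ _).const_smul _
  have hquot : ((fun w : ℍ => slash 12 δ bigDelta w / bigDelta w) ∘ ofComplex) =
      fun w => (slash 12 δ bigDelta ∘ ofComplex) w / (bigDelta ∘ ofComplex) w := rfl
  rw [mu, hquot, logDeriv_div _ (by simpa using hnum) (by simpa using hden)
    (mdifferentiableAt_iff.mp (hmdiff z)) (mdifferentiableAt_iff.mp (mdiff_bigDelta z)),
    logDeriv_comp_ofComplex, logDeriv_comp_ofComplex, D_slash 12 δ mdiff_bigDelta, D_bigDelta,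
    show 12 + 2 = 2 + 12 from rfl, slash_mul]
  simp only [Pi.sub_apply, Pi.mul_apply, Pi.smul_apply, smul_eq_mul]
  field_simp
  push_cast
  ring

theorem mu_mul (α β : GL(2, ℚ)⁺) : mu (α * β) = slash 2 β (mu α) + mu β := by
  simp only [mu_eq, ← slash_slash, toRealGL_mul, kappa_mul _ _ (det_toRealGL_pos β), map_sub,
    map_smul, ← slash_two]
  module

theorem mu_toGLQ (γ : SL(2, ℤ)) : mu (toGLQ γ) = 0 := by
  rw [mu_eq, slash_toGLQ, toRealGL_toGLQ, Nat.cast_ofNat, E2_slash_SL, add_sub_cancel_left,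
    smul_smul, sub_eq_zero]
  congr 1
  field_simp

theorem mu_toGLQ_mul (γ : SL(2, ℤ)) (α : GL(2, ℚ)⁺) : mu (toGLQ γ * α) = mu α := by
  rw [mu_mul, mu_toGLQ, map_zero, zero_add]

theorem mu_mul_toGLQ (α : GL(2, ℚ)⁺) (γ : SL(2, ℤ)) :
    mu (α * toGLQ γ) = slash 2 (toGLQ γ) (mu α) := by
  rw [mu_mul, mu_toGLQ, add_zero]

theorem isBoundedAtImInfty_D {f : ℍ → ℂ} (hf : MDiff f) (hbdd : IsBoundedAtImInfty f) :
    IsBoundedAtImInfty (D f) := by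
  rw [isBoundedAtImInfty_iff] at hbdd ⊢
  obtain ⟨M, A, hM⟩ := hbdd
  refine ⟨‖(2 * Real.pi * I : ℂ)⁻¹‖ * (M / 1), max A 0 + 2, fun z hz => ?_⟩
  have him : ∀ w ∈ Metric.closedBall (z : ℂ) 1, max A 0 < w.im := by
    intro w hw
    have habs : |(w - z).im| ≤ 1 :=
      (Complex.abs_im_le_norm _).trans (by rwa [← dist_eq_norm])
    rw [Complex.sub_im, abs_le, coe_im] at habs
    linarith
  have hpos : ∀ w ∈ Metric.closedBall (z : ℂ) 1, 0 < w.im :=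
    fun w hw => (le_max_right A 0).trans_lt (him w hw)
  rw [normalizedDerivOfComplex, norm_mul]
  refine mul_le_mul_of_nonneg_left ?_ (norm_nonneg _)
  refine Complex.norm_deriv_le_of_forall_mem_sphere_norm_le one_pos ?_ fun w hw => ?_
  · refine DifferentiableOn.diffContOnCl ?_
    rw [closure_ball _ one_ne_zero]
    exact (UpperHalfPlane.mdifferentiable_iff.mp hf).mono hpos
  · have hw := Metric.sphere_subset_closedBall hw
    rw [Function.comp_apply, ofComplex_apply_of_im_pos (hpos w hw)]
    exact hM _ ((le_max_left A 0).trans (him w hw).le)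

theorem isBoundedAtImInfty_serreDerivative {k : ℂ} {f : ℍ → ℂ} (hf : MDiff f)
    (hbdd : IsBoundedAtImInfty f) : IsBoundedAtImInfty (serreDerivative k f) := by
  rw [serreDerivative_eq_sub_smul]
  exact (boundedAtImInftySubalgebra ℂ).sub_mem (isBoundedAtImInfty_D hf hbdd)
    ((EisensteinSeries.isBoundedAtImInfty_E2.mul hbdd).const_smul_left _)

theorem modX_mem (k : ℕ) (f : modularTower k) : modX k f ∈ modularTower (k + 2) := by
  rw [modX_eq_serreDerivative]
  obtain ⟨f, hf⟩ := f
  rw [mem_modularTower_iff] at hf ⊢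
  obtain ⟨hf, ⟨N, hN, hfN⟩, hbdd⟩ := hf
  refine ⟨serreDerivative_mdifferentiable _ hf, ⟨N, hN, fun γ hγ => ?_⟩, fun α => ?_⟩
  · exact_mod_cast serreDerivative_slash_invariant hf (hfN γ hγ)
  · have hequiv := serreDerivative_slash_equivariant (k := k) hf (γ := α)
    push_cast at hequiv ⊢
    rw [hequiv]
    exact isBoundedAtImInfty_serreDerivative (hf.slash _ _) (hbdd α)

theorem modY_mem (k : ℕ) (f : modularTower k) : modY k f ∈ modularTower k :=
  (modularTower k).smul_mem _ f.2

theorem mu_mem (δ : GL(2, ℚ)⁺) : mu δ ∈ modularTower 2 := by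
  rw [mem_modularTower_iff]
  refine ⟨?_, ?_, fun γ => ?_⟩
  · rw [mu_eq, slash_two]
    exact (((E2_mdifferentiable.slash _ _).sub E2_mdifferentiable).const_smul _).sub
      ((mdiff_kappa _).const_smul _)
  · obtain ⟨M, hM, hconj⟩ := exists_Gamma_conj δ one_pos
    refine ⟨M, hM, fun x hx => ?_⟩
    obtain ⟨y, -, hxy⟩ := hconj x hx
    rw [← slash_toGLQ, ← mu_mul_toGLQ, hxy, mu_toGLQ_mul]
  · obtain ⟨γ', β, hδγ, hβ⟩ := exists_eq_toGLQ_mul_upperTriangular (δ * toGLQ γ)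
    rw [← slash_toGLQ, ← mu_mul_toGLQ, hδγ, mu_toGLQ_mul, mu_eq, kappa_eq_zero hβ, smul_zero,
      sub_zero, slash_two]
    have hE2 := EisensteinSeries.isBoundedAtImInfty_E2
    exact ((boundedAtImInftySubalgebra ℂ).sub_mem (hE2.slash _ hβ) hE2).const_smul_left _

theorem modX_slash (k : ℕ) (α : GL(2, ℚ)⁺) (f : modularTower k) :
    modX k ⟨slash k α f, slash_mem_modularTower α f.2⟩ =
      slash (k + 2) α (modX k f) + mu α * modY k ⟨slash k α f, slash_mem_modularTower α f.2⟩ := by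
  have hY : slash (k + 2) α (EisensteinSeries.E2 * modY k f) =
      slash 2 α EisensteinSeries.E2 * ((k : ℂ) / 2) • slash k α f := by
    rw [add_comm k 2, slash_mul, modY, LinearMap.smul_apply, Submodule.subtype_apply, map_smul]
  rw [modX_eq_D_sub, modX_eq_D_sub, D_slash k α (mdiff_of_mem_modularTower f.2), map_sub,
    map_smul, hY, mu_eq]
  ext z
  simp only [modY, Pi.sub_apply, Pi.add_apply, Pi.smul_apply, Pi.mul_apply, smul_eq_mul,
    LinearMap.smul_apply, Submodule.subtype_apply]
  field_simp
  ring

end Derivation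

/-! ### Uniqueness of the `G₂`-expansion -/

/-- The constant `u` in the transformation law `G₂|γ = G₂ + u c / (c z + d)`. -/
def defectG2 : ℂ := -1 / (4 * Real.pi * I)

theorem defectG2_ne_zero : defectG2 ≠ 0 := by
  simp [defectG2]

theorem eisG2_eq : eisG2 = (-1 / 24 : ℂ) • EisensteinSeries.E2 := by
  ext z
  have hq : ∀ n : ℕ, Complex.exp (2 * Real.pi * I * ((n + 1 : ℕ) : ℂ) * (z : ℂ)) =
      (Complex.exp (2 * Real.pi * I * z)) ^ (n + 1) := by
    intro n
    rw [← Complex.exp_nat_mul]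
    congr 1
    ring
  rw [Pi.smul_apply, EisensteinSeries.E2_eq_tsum_cexp, eisG2, bernoulli_two,
    tsum_pnat_eq_tsum_succ (f := fun n => (ArithmeticFunction.sigma 1 n : ℂ) * _ ^ n)]
  simp only [hq, smul_eq_mul]
  push_cast
  ring

theorem mdiff_eisG2 : MDiff eisG2 := by
  rw [eisG2_eq]
  exact E2_mdifferentiable.const_smul _

theorem isBoundedAtImInfty_eisG2 : IsBoundedAtImInfty eisG2 := by
  rw [eisG2_eq]
  exact EisensteinSeries.isBoundedAtImInfty_E2.const_smul_left _

theorem eisG2_slash (γ : SL(2, ℤ)) : eisG2 ∣[(2 : ℤ)] γ = eisG2 + defectG2 • kappa γ := by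
  rw [eisG2_eq, ModularForm.SL_smul_slash, E2_slash_SL, smul_add, smul_smul]
  congr 2
  rw [defectG2]
  field_simp
  norm_num

theorem denom_SL (γ : SL(2, ℤ)) (z : ℍ) : denom γ z = (γ 1 0 : ℂ) * z + γ 1 1 := rfl

theorem kappa_SL_apply (γ : SL(2, ℤ)) (z : ℍ) : kappa γ z = ((γ 1 0 : ℤ) : ℂ) / denom γ z := rfl

theorem apply_smul_eq_slash (k : ℤ) (f : ℍ → ℂ) (γ : SL(2, ℤ)) (z : ℍ) :
    f (γ • z) = denom γ z ^ k * (f ∣[k] γ) z := by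
  rw [ModularForm.SL_slash_apply, mul_left_comm, ← zpow_add₀ (denom_ne_zero γ z)]
  simp

theorem eisG2_smul (γ : SL(2, ℤ)) (z : ℍ) :
    eisG2 (γ • z) = denom γ z ^ 2 * (eisG2 z + defectG2 * kappa γ z) := by
  rw [apply_smul_eq_slash 2 eisG2 γ z, eisG2_slash]
  rfl

/-- An element of `Γ(N)` with lower row `(N t, N² t m + 1)`. -/
def gammaElt (N : ℕ) (t m : ℤ) : SL(2, ℤ) :=
  ⟨!![1, N * m; N * t, N * t * (N * m) + 1], by rw [Matrix.det_fin_two_of]; ring⟩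

theorem gammaElt_mem (N : ℕ) (t m : ℤ) : gammaElt N t m ∈ Gamma N := by
  rw [Gamma_mem]
  refine ⟨?_, ?_, ?_, ?_⟩ <;> simp [gammaElt]

section LowerRow

open MvPolynomial

theorem eq_zero_of_eval_lowerRow {N : ℕ} (hN : 0 < N) {P : MvPolynomial (Fin 2) ℂ}
    (hP : ∀ γ ∈ Gamma N, eval ![(γ 1 0 : ℂ), (γ 1 1 : ℂ)] P = 0) : P = 0 := by
  have hN' : (N : ℂ) ≠ 0 := by exact_mod_cast hN.ne'
  have hinf : (Set.range fun t : ℕ => (N : ℂ) * (t + 1)).Infinite :=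
    Set.infinite_range_of_injective fun t t' htt' => by simpa [hN'] using htt'
  refine funext_set ![Set.range fun t : ℕ => (N : ℂ) * (t + 1), Set.univ]
    (Fin.forall_fin_two.mpr ⟨hinf, Set.infinite_univ⟩) fun x hx => ?_
  obtain ⟨t, ht : (N : ℂ) * (t + 1) = x 0⟩ := hx 0 trivial
  have hx0 : x 0 ≠ 0 := ht ▸ mul_ne_zero hN' t.cast_add_one_ne_zero
  set p : Polynomial ℂ := aeval ![Polynomial.C (x 0), Polynomial.X] P
  have hp_eval (y : ℂ) : p.eval y = eval ![x 0, y] P := by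
    rw [← Polynomial.coe_evalRingHom, map_aeval]
    change _ = eval₂Hom (RingHom.id ℂ) ![x 0, y] P
    congr 2
    · ext; simp
    · ext i; fin_cases i <;> simp
  have hp : p = 0 := by
    refine Polynomial.eq_zero_of_infinite_isRoot p
      (Set.infinite_of_injective_forall_mem (f := fun m : ℕ => x 0 * (N * m) + 1) ?_ fun m => ?_)
    · intro m m' hmm'
      simpa [hx0, hN'] using hmm'
    · simpa [gammaElt, hp_eval, ← ht] using hP _ (gammaElt_mem N (t + 1) m)
  have hx_eq : ![x 0, x 1] = x := by ext i; fin_cases i <;> rfl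
  rw [map_zero, ← hx_eq, ← hp_eval, hp, Polynomial.eval_zero]

/-- The two linear forms are independent in `(c, d)`, so this reduces to the lower rows. -/
theorem eq_zero_of_eval_linearForms {N : ℕ} (hN : 0 < N) {z w u : ℂ} (hu : u ≠ 0)
    {P : MvPolynomial (Fin 2) ℂ} (hP : ∀ γ ∈ Gamma N,
      eval ![γ 1 0 * z + γ 1 1, (γ 1 0 * z + γ 1 1) * w + u * γ 1 0] P = 0) : P = 0 := by
  let L : MvPolynomial (Fin 2) ℂ := X 0 * C z + X 1
  let R : MvPolynomial (Fin 2) ℂ := bind₁ ![L, L * C w + C u * X 0] P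
  have hR_eval (c d : ℂ) :
      eval ![c, d] R = eval ![c * z + d, (c * z + d) * w + u * c] P := by
    have := eval₂Hom_bind₁ (RingHom.id ℂ) ![c, d] ![L, L * C w + C u * X 0] P
    simp only [R]
    refine this.trans ?_
    congr 2
    ext i
    fin_cases i <;> simp [L]
  have hR : R = 0 := eq_zero_of_eval_lowerRow hN fun γ hγ => by rw [hR_eval, hP γ hγ]
  refine MvPolynomial.funext fun x => ?_
  have hx := hR_eval ((x 1 - x 0 * w) / u) (x 0 - (x 1 - x 0 * w) / u * z)
  have hx_eq : ![x 0, x 1] = x := by ext i; fin_cases i <;> rfl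
  rw [add_sub_cancel, mul_div_cancel₀ _ hu, add_sub_cancel, hx_eq, hR] at hx
  simpa using hx.symm

/-- `a G₂^i` with `a` of weight `k` transforms through the monomial `U^(k+i) W^i` in
`U = c z + d` and `W = (c z + d) G₂(z) + u c`; this is its exponent as a function of `(i, k)`. -/
def rowExponent (p : ℕ × ℕ) : Fin 2 →₀ ℕ :=
  Finsupp.single 0 (p.2 + p.1) + Finsupp.single 1 p.1

theorem rowExponent_injective : Function.Injective rowExponent := by
  rintro ⟨i, k⟩ ⟨i', k'⟩ h
  have h0 := DFunLike.congr_fun h 0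
  have h1 := DFunLike.congr_fun h 1
  simp only [rowExponent, Finsupp.add_apply, Finsupp.single_apply] at h0 h1
  ext <;> simp_all

theorem eval_monomial_rowExponent (p : ℕ × ℕ) (a : ℂ) (x : Fin 2 → ℂ) :
    eval x (monomial (rowExponent p) a) = a * (x 0 ^ (p.2 + p.1) * x 1 ^ p.1) := by
  rw [eval_monomial, Finsupp.prod_fintype _ _ fun _ => pow_zero _, Fin.prod_univ_two]
  simp [rowExponent]

theorem mul_eisG2_pow_smul {p : ℕ × ℕ} {a : ℍ → ℂ} {γ : SL(2, ℤ)}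
    (ha : a ∣[(p.2 : ℤ)] γ = a) (z : ℍ) :
    (a * eisG2 ^ p.1) (γ • z) = eval ![γ 1 0 * (z : ℂ) + γ 1 1,
      (γ 1 0 * (z : ℂ) + γ 1 1) * eisG2 z + defectG2 * γ 1 0]
      (monomial (rowExponent p) (a z)) := by
  have hden := denom_ne_zero γ z
  have hG2 : eisG2 (γ • z) =
      denom γ z * (denom γ z * eisG2 z + defectG2 * γ 1 0) := by
    rw [eisG2_smul, kappa_SL_apply]
    field_simp
  rw [Pi.mul_apply, Pi.pow_apply, apply_smul_eq_slash p.2 a γ z, ha, hG2, zpow_natCast,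
    ← denom_SL, eval_monomial_rowExponent]
  simp only [Matrix.cons_val_zero, Matrix.cons_val_one, pow_add, mul_pow]
  ring

theorem evalWith_of (T : ∀ k, modularTower k →ₗ[ℂ] (ℍ → ℂ)) (p : ℕ × ℕ) (a : modularTower p.2) :
    evalWith T (DirectSum.lof ℂ (ℕ × ℕ) (fun p => modularTower p.2) p a) =
      T p.2 a * eisG2 ^ p.1 := by
  rw [evalWith, DirectSum.toModule_lof]
  rfl

open Classical in
theorem evalWith_eq_sum (T : ∀ k, modularTower k →ₗ[ℂ] (ℍ → ℂ)) (a : Coeffs) :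
    evalWith T a = ∑ p ∈ DFinsupp.support a, T p.2 (a p) * eisG2 ^ p.1 := by
  conv_lhs => rw [← DirectSum.sum_support_of a, map_sum]
  exact Finset.sum_congr rfl fun p _ => evalWith_of T p (a p)

theorem exists_common_level (s : Finset (ℕ × ℕ)) (a : ∀ p : ℕ × ℕ, modularTower p.2) :
    ∃ N : ℕ, 0 < N ∧ ∀ p ∈ s, ∀ γ ∈ Gamma N, (a p : ℍ → ℂ) ∣[(p.2 : ℤ)] γ = a p := by
  choose n hn h using fun p => (mem_modularTower_iff.mp (a p).2).2.1
  exact ⟨∏ p ∈ s, n p, Finset.prod_pos fun p _ => hn p, fun p hp γ hγ =>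
    h p γ (Gamma_le_of_dvd (Finset.dvd_prod_of_mem n hp) hγ)⟩

theorem ker_evalWith : LinearMap.ker (evalWith fun k => (modularTower k).subtype) = ⊥ := by
  classical
  rw [LinearMap.ker_eq_bot']
  intro a ha
  rw [evalWith_eq_sum] at ha
  set s := DFinsupp.support a
  obtain ⟨N, hN, hlevel⟩ := exists_common_level s a
  have hpoly (z : ℍ) : ∑ p ∈ s, monomial (rowExponent p) ((a p : ℍ → ℂ) z) = 0 := by
    refine eq_zero_of_eval_linearForms hN (z := z) (w := eisG2 z) defectG2_ne_zero fun γ hγ => ?_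
    rw [map_sum, ← Pi.zero_apply (M := fun _ : ℍ => ℂ) (γ • z), ← ha, Finset.sum_apply]
    exact Finset.sum_congr rfl fun p hp => (mul_eisG2_pow_smul (hlevel p hp γ hγ) z).symm
  refine DFinsupp.ext fun p => ?_
  by_cases hp : p ∈ s
  · refine Subtype.ext (funext fun z => ?_)
    simpa [coeff_sum, coeff_monomial, rowExponent_injective.eq_iff, hp] using
      congrArg (coeff (rowExponent p)) (hpoly z)
  · exact DFinsupp.notMem_support_iff.mp hp

end LowerRow

theorem coeffs_evalWith (a : Coeffs) :
    coeffs (evalWith (fun k => (modularTower k).subtype) a) = a :=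
  LinearMap.leftInverse_apply_of_inj ker_evalWith a

theorem extend_mul_eisG2_pow (T : ∀ k, modularTower k →ₗ[ℂ] (ℍ → ℂ)) {k : ℕ} {a : ℍ → ℂ}
    (ha : a ∈ modularTower k) (i : ℕ) : extend T (a * eisG2 ^ i) = T k ⟨a, ha⟩ * eisG2 ^ i := by
  have h := evalWith_of (fun k => (modularTower k).subtype) (i, k) ⟨a, ha⟩
  simp only [Submodule.subtype_apply] at h
  rw [← h, extend, LinearMap.comp_apply, coeffs_evalWith, evalWith_of]

/-! ### Existence of the `G₂`-expansion -/

theorem mul_pow_slash_SL (k : ℤ) (f g : ℍ → ℂ) (n : ℕ) (α : SL(2, ℤ)) :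
    (f * g ^ n) ∣[k + 2 * n] α = f ∣[k] α * (g ∣[(2 : ℤ)] α) ^ n := by
  induction n with
  | zero => simp
  | succ n ih =>
    have hweight : k + 2 * ((n + 1 : ℕ) : ℤ) = k + 2 * n + 2 := by push_cast; ring
    rw [hweight, pow_succ, ← mul_assoc, ModularForm.mul_slash_SL2, ih, pow_succ, mul_assoc]

theorem isBoundedAtImInfty_kappa (γ : SL(2, ℤ)) : IsBoundedAtImInfty (kappa γ) := by
  rw [isBoundedAtImInfty_iff]
  refine ⟨1, 1, fun z hz => ?_⟩
  have him : ((γ 1 0 : ℂ) * z + γ 1 1).im = (γ 1 0 : ℝ) * z.im := by simp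
  rw [kappa_SL_apply, norm_div, div_le_one (norm_pos_iff.mpr (denom_ne_zero γ z)), denom_SL]
  refine le_trans ?_ (Complex.abs_im_le_norm _)
  rw [him, abs_mul, Complex.norm_intCast, abs_of_pos z.im_pos]
  exact le_mul_of_one_le_right (abs_nonneg _) hz

theorem isBoundedAtImInfty_eisG2_slash (α : SL(2, ℤ)) :
    IsBoundedAtImInfty (eisG2 ∣[(2 : ℤ)] α) := by
  rw [eisG2_slash]
  exact isBoundedAtImInfty_eisG2.add ((isBoundedAtImInfty_kappa α).const_smul_left _)

theorem isBoundedAtImInfty_mul_pow_slash {k : ℤ} {f g : ℍ → ℂ} {α : SL(2, ℤ)}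
    (hf : IsBoundedAtImInfty (f ∣[k] α)) (hg : IsBoundedAtImInfty (g ∣[(2 : ℤ)] α)) (n : ℕ) :
    IsBoundedAtImInfty ((f * g ^ n) ∣[k + 2 * n] α) := by
  rw [mul_pow_slash_SL]
  exact hf.mul ((boundedAtImInftySubalgebra ℂ).pow_mem hg n)

theorem isQuasimodularForm_mul_eisG2_pow {N k : ℕ} {a : ℍ → ℂ} (ha0 : a ≠ 0) (ha : MDiff a)
    (hslash : ∀ γ ∈ Gamma N, a ∣[(k : ℤ)] γ = a)
    (hbdd : ∀ α : SL(2, ℤ), IsBoundedAtImInfty (a ∣[(k : ℤ)] α)) (i : ℕ) :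
    IsQuasimodularForm N (k + 2 * i) i (a * eisG2 ^ i) := by
  refine Or.inr ⟨ha.mul (mdiff_eisG2.pow i),
    fun j => ((i.choose j : ℂ) * defectG2 ^ j) • (a * eisG2 ^ (i - j)),
    fun j _ => (ha.mul (mdiff_eisG2.pow _)).const_smul _, ?_, fun γ hγ z => ?_, fun j hj α => ?_⟩
  · simp [ha0, defectG2_ne_zero]
  · have h := congrFun (mul_pow_slash_SL k a eisG2 i γ) z
    rw [hslash γ hγ, eisG2_slash, ModularForm.SL_slash_apply, mul_comm] at h
    push_cast
    rw [h, Pi.mul_apply, Pi.pow_apply, Pi.add_apply, add_comm, add_pow, Finset.mul_sum]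
    refine Finset.sum_congr rfl fun j _ => ?_
    rw [← kappa_SL_apply]
    simp only [Pi.smul_apply, Pi.mul_apply, Pi.pow_apply, smul_eq_mul]
    ring
  · have hweight : ((k + 2 * i : ℕ) : ℤ) - 2 * j = k + 2 * ((i - j : ℕ) : ℤ) := by
      push_cast [Nat.cast_sub hj]
      ring
    rw [ModularForm.SL_smul_slash, hweight]
    exact (isBoundedAtImInfty_mul_pow_slash (hbdd α)
      (isBoundedAtImInfty_eisG2_slash α) _).const_smul_left _

theorem mul_eisG2_pow_mem_QM {k : ℕ} {a : ℍ → ℂ} (ha : a ∈ modularTower k) (i : ℕ) :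
    a * eisG2 ^ i ∈ QM := by
  by_cases ha0 : a = 0
  · rw [ha0, zero_mul]
    exact QM.zero_mem
  · obtain ⟨ha, ⟨N, hN, hslash⟩, hbdd⟩ := mem_modularTower_iff.mp ha
    exact Submodule.subset_span
      ⟨N, k + 2 * i, i, hN, isQuasimodularForm_mul_eisG2_pow ha0 ha hslash hbdd i⟩

/-- The multiple `φ` of `G₂` with `φ|γ = φ + c / (c z + d)`. -/
def normG2 : ℍ → ℂ := defectG2⁻¹ • eisG2

theorem normG2_slash (γ : SL(2, ℤ)) : normG2 ∣[(2 : ℤ)] γ = normG2 + kappa γ := by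
  rw [normG2, ModularForm.SL_smul_slash, eisG2_slash, smul_add, smul_smul,
    inv_mul_cancel₀ defectG2_ne_zero, one_smul]

theorem normG2_smul (γ : SL(2, ℤ)) (z : ℍ) :
    normG2 (γ • z) = denom γ z ^ 2 * (normG2 z + kappa γ z) := by
  rw [apply_smul_eq_slash 2 normG2 γ z, normG2_slash]
  rfl

theorem mdiff_normG2 : MDiff normG2 := mdiff_eisG2.const_smul _

theorem kappa_SL_mul (γ γ' : SL(2, ℤ)) (z : ℍ) :
    kappa (γ * γ' : SL(2, ℤ)) z = (denom γ' z ^ 2)⁻¹ * kappa γ (γ' • z) + kappa γ' z := by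
  have h := kappa_mul_apply γ γ' (by simp) z
  simpa using h

theorem denom_SL_mul (γ γ' : SL(2, ℤ)) (z : ℍ) :
    denom (γ * γ' : SL(2, ℤ)) z = denom γ (γ' • z : ℍ) * denom γ' z := by
  have h := denom_cocycle_σ γ γ' z
  rw [σ_of_det_pos (by simp)] at h
  simpa using h

theorem kappa_gammaElt_injective {N : ℕ} (hN : 0 < N) (z : ℍ) :
    Function.Injective fun t : ℕ => kappa (gammaElt N t 0) z := by
  intro t t' h
  have hN' : (N : ℂ) ≠ 0 := by exact_mod_cast hN.ne'
  have hkappa (t : ℕ) : kappa (gammaElt N t 0) z = N * t / (N * t * z + 1) := by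
    rw [kappa_SL_apply, denom_SL]
    simp [gammaElt]
  have hden (t : ℕ) : (N : ℂ) * t * z + 1 ≠ 0 := by
    have hden := denom_ne_zero (gammaElt N t 0) z
    rw [denom_SL] at hden
    simpa [gammaElt] using hden
  simp only [hkappa, div_eq_div_iff (hden t) (hden t')] at h
  exact_mod_cast mul_left_cancel₀ hN' (show (N : ℂ) * t = N * t' by linear_combination h)

section Taylor

open Polynomial

/-- The polynomial `∑ f_j(z) T^j` whose value at `T = c / (c z + d)` is `(f|γ)(z)`. -/
def qmPoly (g : ℕ → ℍ → ℂ) (s : ℕ) (z : ℍ) : ℂ[X] :=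
  ∑ j ∈ Finset.range (s + 1), C (g j z) * X ^ j

/-- The coefficient of `φ^i` in the `φ`-expansion of a quasimodular form, `φ = normG2`: its value
at `z` is the `i`-th Taylor coefficient at `-φ(z)` of `∑ f_j(z) T^j`. -/
def qmCoeff (g : ℕ → ℍ → ℂ) (s i : ℕ) (z : ℍ) : ℂ := (taylor (-normG2 z) (qmPoly g s z)).coeff i

theorem qmCoeff_eq_sum (g : ℕ → ℍ → ℂ) (s i : ℕ) : qmCoeff g s i =
    ∑ j ∈ Finset.range (s + 1), (j.choose i : ℂ) • (g j * (-normG2) ^ (j - i)) := by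
  ext z
  simp only [qmCoeff, qmPoly, taylor_apply, Polynomial.sum_comp, mul_comp, pow_comp, X_comp,
    C_comp, finsetSum_coeff, coeff_C_mul, coeff_X_add_C_pow, Finset.sum_apply, Pi.smul_apply,
    Pi.mul_apply, Pi.pow_apply, Pi.neg_apply, smul_eq_mul]
  exact Finset.sum_congr rfl fun j _ => by ring

theorem qmPoly_eval_zero_eq_sum (g : ℕ → ℍ → ℂ) (s : ℕ) (z : ℍ) :
    (qmPoly g s z).eval 0 = ∑ i ∈ Finset.range (s + 1), qmCoeff g s i z * normG2 z ^ i := by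
  have hdeg : (qmPoly g s z).natDegree ≤ s := natDegree_sum_le_of_forall_le _ _ fun j hj =>
    (natDegree_C_mul_X_pow_le _ _).trans (Nat.lt_succ_iff.mp (Finset.mem_range.mp hj))
  have heval : (taylor (-normG2 z) (qmPoly g s z)).eval (normG2 z) = (qmPoly g s z).eval 0 := by
    rw [taylor_eval, add_neg_cancel]
  rw [← heval, eval_eq_sum_range' (n := s + 1) (by rw [natDegree_taylor]; lia)]
  rfl

section Transform

variable {N k s : ℕ} {f : ℍ → ℂ} {g : ℕ → ℍ → ℂ}

/-- The transformation law of a quasimodular form under `Γ(N)`. -/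
def QMTransform (N k s : ℕ) (f : ℍ → ℂ) (g : ℕ → ℍ → ℂ) : Prop :=
  ∀ γ ∈ Gamma N, ∀ z : ℍ, denom γ z ^ (-(k : ℤ)) * f (γ • z) =
    ∑ j ∈ Finset.range (s + 1), g j z * (((γ 1 0 : ℤ) : ℂ) / denom γ z) ^ j

theorem QMTransform.eval_kappa (h : QMTransform N k s f g) {γ : SL(2, ℤ)} (hγ : γ ∈ Gamma N)
    (z : ℍ) : (qmPoly g s z).eval (kappa γ z) = denom γ z ^ (-(k : ℤ)) * f (γ • z) := by
  rw [h γ hγ z, qmPoly, eval_finsetSum, kappa_SL_apply]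
  simp

theorem QMTransform.eval_zero (h : QMTransform N k s f g) (z : ℍ) :
    (qmPoly g s z).eval 0 = f z := by
  have hone := h.eval_kappa (Gamma N).one_mem z
  rw [kappa_SL_apply] at hone
  simpa using hone

/-- Both sides agree at the infinitely many points `κ_{γ'}(γ z)`, `γ' ∈ Γ(N)`. -/
theorem QMTransform.qmPoly_smul (h : QMTransform N k s f g) (hN : 0 < N) {γ : SL(2, ℤ)}
    (hγ : γ ∈ Gamma N) (z : ℍ) : qmPoly g s (γ • z) = C (denom γ z ^ k) *
      (qmPoly g s z).comp (C (denom γ z ^ 2)⁻¹ * X + C (kappa γ z)) := by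
  refine eq_of_infinite_eval_eq _ _ (Set.infinite_of_injective_forall_mem
    (kappa_gammaElt_injective hN (γ • z)) fun t => ?_)
  have hden := denom_ne_zero γ z
  have h_smul := h.eval_kappa (gammaElt_mem N t 0) (γ • z)
  have h_mul := h.eval_kappa ((Gamma N).mul_mem (gammaElt_mem N t 0) hγ) z
  rw [kappa_SL_mul, denom_SL_mul, mul_zpow, mul_smul, zpow_neg (denom γ z), zpow_natCast] at h_mul
  simp only [Set.mem_ofPred_eq, eval_mul, eval_comp, eval_add, eval_C, eval_X]
  rw [h_smul, h_mul]
  field_simp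

theorem QMTransform.taylor_smul (h : QMTransform N k s f g) (hN : 0 < N) {γ : SL(2, ℤ)}
    (hγ : γ ∈ Gamma N) (z : ℍ) :
    taylor (-normG2 (γ • z)) (qmPoly g s (γ • z)) = C (denom γ z ^ k) *
      (taylor (-normG2 z) (qmPoly g s z)).comp (C (denom γ z ^ 2)⁻¹ * X) := by
  have hden := denom_ne_zero γ z
  rw [h.qmPoly_smul hN hγ, normG2_smul, taylor_mul, taylor_C, taylor_apply, taylor_apply,
    comp_assoc, comp_assoc]
  congr 2
  simp only [add_comp, mul_comp, C_comp, X_comp, mul_add, ← C_mul, add_assoc, ← C_add]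
  congr 2
  field_simp
  ring

theorem QMTransform.qmCoeff_slash (h : QMTransform N k s f g) (hN : 0 < N) {γ : SL(2, ℤ)}
    (hγ : γ ∈ Gamma N) (i : ℕ) : qmCoeff g s i ∣[(k : ℤ) - 2 * i] γ = qmCoeff g s i := by
  ext z
  have hden := denom_ne_zero γ z
  rw [ModularForm.SL_slash_apply, qmCoeff, qmCoeff, h.taylor_smul hN hγ, coeff_C_mul,
    comp_C_mul_X_coeff, neg_sub, zpow_sub₀ hden, inv_pow, ← pow_mul]
  norm_cast
  field_simp

end Transform

end Taylor

theorem mdiff_qmCoeff {g : ℕ → ℍ → ℂ} {s : ℕ} (hg : ∀ j ≤ s, MDiff (g j)) (i : ℕ) :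
    MDiff (qmCoeff g s i) := by
  rw [qmCoeff_eq_sum]
  exact MDifferentiable.sum fun j hj => ((hg j (Nat.lt_succ_iff.mp (Finset.mem_range.mp hj))).mul
    (mdiff_normG2.neg.pow _)).const_smul _

theorem isBoundedAtImInfty_qmCoeff_slash {k s : ℕ} {g : ℕ → ℍ → ℂ}
    (hbdd : ∀ j ≤ s, ∀ α : SL(2, ℤ), IsBoundedAtImInfty (g j ∣[(k : ℤ) - 2 * j] α)) (i : ℕ)
    (α : SL(2, ℤ)) : IsBoundedAtImInfty (qmCoeff g s i ∣[(k : ℤ) - 2 * i] α) := by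
  rw [qmCoeff_eq_sum, SlashAction.sum_slash]
  refine (boundedAtImInftySubalgebra ℂ).sum_mem fun j hj => ?_
  rw [ModularForm.SL_smul_slash]
  rcases le_or_gt i j with hij | hij
  · have hweight : (k : ℤ) - 2 * i = (k : ℤ) - 2 * j + 2 * ((j - i : ℕ) : ℤ) := by
      push_cast [Nat.cast_sub hij]
      ring
    have hnorm : IsBoundedAtImInfty ((-normG2) ∣[(2 : ℤ)] α) := by
      rw [SlashAction.neg_slash, normG2_slash]
      exact ((isBoundedAtImInfty_eisG2.const_smul_left _).add (isBoundedAtImInfty_kappa α)).neg_left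
    rw [hweight]
    exact (isBoundedAtImInfty_mul_pow_slash
      (hbdd j (Nat.lt_succ_iff.mp (Finset.mem_range.mp hj)) α) hnorm _).const_smul_left _
  · rw [Nat.choose_eq_zero_of_lt hij, Nat.cast_zero, zero_smul]
    exact Filter.const_boundedAtFilter _ (0 : ℂ)

/-- The products `a G₂^i` with `a` a modular form. -/
def qmMonomials : Set (ℍ → ℂ) := {f | ∃ k i : ℕ, ∃ a ∈ modularTower k, f = a * eisG2 ^ i}

theorem mul_eisG2_pow_mem_span {N : ℕ} (hN : 0 < N) {k : ℤ} {a : ℍ → ℂ} (ha : MDiff a)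
    (hslash : ∀ γ ∈ Gamma N, a ∣[k] γ = a)
    (hbdd : ∀ α : SL(2, ℤ), IsBoundedAtImInfty (a ∣[k] α)) (i : ℕ) :
    a * eisG2 ^ i ∈ Submodule.span ℂ qmMonomials := by
  rcases lt_or_ge k 0 with hk | hk
  · have : NeZero N := ⟨hN.ne'⟩
    obtain ⟨F, rfl⟩ := exists_modularForm_coe_eq hN ha hslash hbdd
    rw [ModularForm.isZero_of_neg_weight hk F, FunLike.coe_zero, zero_mul]
    exact Submodule.zero_mem _
  · obtain ⟨l, rfl⟩ := Int.eq_ofNat_of_zero_le hk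
    exact Submodule.subset_span
      ⟨l, i, a, mem_modularTower_iff.mpr ⟨ha, ⟨N, hN, hslash⟩, hbdd⟩, rfl⟩

theorem mem_span_of_isQuasimodularForm {N k s : ℕ} (hN : 0 < N) {f : ℍ → ℂ}
    (hf : IsQuasimodularForm N k s f) : f ∈ Submodule.span ℂ qmMonomials := by
  rcases hf with ⟨rfl, -⟩ | ⟨-, g, hg, -, h, hbdd⟩
  · exact Submodule.zero_mem _
  have htransform : QMTransform N k s f g := h
  have hexpansion : f =
      ∑ i ∈ Finset.range (s + 1), (defectG2⁻¹ ^ i) • (qmCoeff g s i * eisG2 ^ i) := by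
    ext z
    rw [← htransform.eval_zero z, qmPoly_eval_zero_eq_sum, Finset.sum_apply]
    refine Finset.sum_congr rfl fun i _ => ?_
    simp only [normG2, Pi.smul_apply, Pi.mul_apply, Pi.pow_apply, smul_eq_mul]
    ring
  rw [hexpansion]
  exact Submodule.sum_mem _ fun i _ => Submodule.smul_mem _ _ <| mul_eisG2_pow_mem_span hN
    (mdiff_qmCoeff hg i) (fun γ hγ => htransform.qmCoeff_slash hN hγ i)
    (isBoundedAtImInfty_qmCoeff_slash hbdd i) i

theorem QM_eq_span : QM = Submodule.span ℂ qmMonomials := by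
  refine le_antisymm (Submodule.span_le.mpr ?_) (Submodule.span_le.mpr ?_)
  · rintro f ⟨N, k, s, hN, hf⟩
    exact mem_span_of_isQuasimodularForm hN hf
  · rintro _ ⟨k, i, a, ha, rfl⟩
    exact mul_eisG2_pow_mem_QM ha i

/-! ### Operators on quasimodular forms -/

theorem eq_on_QM {L L' : (ℍ → ℂ) →ₗ[ℂ] (ℍ → ℂ)}
    (h : ∀ (k i : ℕ), ∀ a ∈ modularTower k, L (a * eisG2 ^ i) = L' (a * eisG2 ^ i))
    {f : ℍ → ℂ} (hf : f ∈ QM) : L f = L' f := by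
  rw [QM_eq_span] at hf
  refine LinearMap.eqOn_span (f := L) (g := L') ?_ hf
  rintro _ ⟨k, i, a, ha, rfl⟩
  exact h k i a ha

theorem map_mem_QM {L : (ℍ → ℂ) →ₗ[ℂ] (ℍ → ℂ)}
    (h : ∀ (k i : ℕ), ∀ a ∈ modularTower k, L (a * eisG2 ^ i) ∈ QM)
    {f : ℍ → ℂ} (hf : f ∈ QM) : L f ∈ QM := by
  rw [QM_eq_span] at hf
  refine (Submodule.span_le (p := QM.comap L)).mpr ?_ hf
  rintro _ ⟨k, i, a, ha, rfl⟩
  exact h k i a ha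

theorem mem_QM_of_mem_modularTower {k : ℕ} {a : ℍ → ℂ} (ha : a ∈ modularTower k) : a ∈ QM := by
  simpa using mul_eisG2_pow_mem_QM ha 0

theorem mul_mem_QM {f g : ℍ → ℂ} (hf : f ∈ QM) (hg : g ∈ QM) : f * g ∈ QM := by
  refine map_mem_QM (L := LinearMap.mulRight ℂ g) (fun k i a ha => ?_) hf
  refine map_mem_QM (L := LinearMap.mulLeft ℂ (a * eisG2 ^ i)) (fun l j b hb => ?_) hg
  rw [LinearMap.mulLeft_apply, mul_mul_mul_comm, ← pow_add]
  exact mul_eisG2_pow_mem_QM (mul_mem_modularTower ha hb) _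

section Extend

variable {T : ∀ k, modularTower k →ₗ[ℂ] (ℍ → ℂ)}

theorem extend_mem_QM (w : ℕ → ℕ) (hT : ∀ k (a : modularTower k), T k a ∈ modularTower (w k))
    {f : ℍ → ℂ} (hf : f ∈ QM) : extend T f ∈ QM := by
  refine map_mem_QM (fun k i a ha => ?_) hf
  rw [extend_mul_eisG2_pow T ha]
  exact mul_eisG2_pow_mem_QM (hT k ⟨a, ha⟩) i

theorem extend_mul_of_map_mul
    (hT : ∀ k l (a : modularTower k) (b : modularTower l),
      T (k + l) ⟨a * b, mul_mem_modularTower a.2 b.2⟩ = T k a * T l b)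
    {f g : ℍ → ℂ} (hf : f ∈ QM) (hg : g ∈ QM) : extend T (f * g) = extend T f * extend T g := by
  refine eq_on_QM (L := extend T ∘ₗ LinearMap.mulRight ℂ g)
    (L' := LinearMap.mulRight ℂ (extend T g) ∘ₗ extend T) (fun k i a ha => ?_) hf
  refine eq_on_QM (L := extend T ∘ₗ LinearMap.mulLeft ℂ (a * eisG2 ^ i))
    (L' := LinearMap.mulLeft ℂ (extend T (a * eisG2 ^ i)) ∘ₗ extend T) (fun l j b hb => ?_) hg
  simp only [LinearMap.comp_apply, LinearMap.mulLeft_apply]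
  rw [mul_mul_mul_comm, ← pow_add, extend_mul_eisG2_pow T (mul_mem_modularTower ha hb),
    extend_mul_eisG2_pow T ha, extend_mul_eisG2_pow T hb, hT k l ⟨a, ha⟩ ⟨b, hb⟩, pow_add,
    mul_mul_mul_comm]

theorem extend_mul_of_leibniz
    (hT : ∀ k l (a : modularTower k) (b : modularTower l),
      T (k + l) ⟨a * b, mul_mem_modularTower a.2 b.2⟩ = T k a * b + a * T l b)
    {f g : ℍ → ℂ} (hf : f ∈ QM) (hg : g ∈ QM) :
    extend T (f * g) = extend T f * g + f * extend T g := by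
  refine eq_on_QM (L := extend T ∘ₗ LinearMap.mulRight ℂ g)
    (L' := LinearMap.mulRight ℂ g ∘ₗ extend T + LinearMap.mulRight ℂ (extend T g))
    (fun k i a ha => ?_) hf
  refine eq_on_QM (L := extend T ∘ₗ LinearMap.mulLeft ℂ (a * eisG2 ^ i))
    (L' := LinearMap.mulLeft ℂ (extend T (a * eisG2 ^ i)) +
      LinearMap.mulLeft ℂ (a * eisG2 ^ i) ∘ₗ extend T)
    (fun l j b hb => ?_) hg
  simp only [LinearMap.comp_apply, LinearMap.mulLeft_apply, LinearMap.add_apply]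
  rw [mul_mul_mul_comm, ← pow_add, extend_mul_eisG2_pow T (mul_mem_modularTower ha hb),
    extend_mul_eisG2_pow T ha, extend_mul_eisG2_pow T hb, hT k l ⟨a, ha⟩ ⟨b, hb⟩]
  ring

end Extend

section OnMonomials

variable {k : ℕ} {a : ℍ → ℂ}

theorem qslash_mul_eisG2_pow (α : GL(2, ℚ)⁺) (ha : a ∈ modularTower k) (i : ℕ) :
    qslash α (a * eisG2 ^ i) = slash k α a * eisG2 ^ i :=
  extend_mul_eisG2_pow _ ha i

theorem opX_mul_eisG2_pow (ha : a ∈ modularTower k) (i : ℕ) :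
    opX (a * eisG2 ^ i) = modX k ⟨a, ha⟩ * eisG2 ^ i :=
  extend_mul_eisG2_pow _ ha i

theorem opY_mul_eisG2_pow (ha : a ∈ modularTower k) (i : ℕ) :
    opY (a * eisG2 ^ i) = ((k : ℂ) / 2) • (a * eisG2 ^ i) := by
  rw [← smul_mul_assoc]
  exact extend_mul_eisG2_pow _ ha i

theorem qslash_of_mem_modularTower (α : GL(2, ℚ)⁺) (ha : a ∈ modularTower k) :
    qslash α a = slash k α a := by
  simpa using qslash_mul_eisG2_pow α ha 0

theorem opY_of_mem_modularTower (ha : a ∈ modularTower k) : opY a = ((k : ℂ) / 2) • a := by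
  simpa using opY_mul_eisG2_pow ha 0

end OnMonomials

section OnQM

variable {f g : ℍ → ℂ}

theorem qslash_mem (α : GL(2, ℚ)⁺) (hf : f ∈ QM) : qslash α f ∈ QM :=
  extend_mem_QM id (fun _ a => slash_mem_modularTower α a.2) hf

theorem opX_mem (hf : f ∈ QM) : opX f ∈ QM :=
  extend_mem_QM (· + 2) modX_mem hf

theorem opX_pow_mem (hf : f ∈ QM) (n : ℕ) : (opX ^ n) f ∈ QM := by
  induction n with
  | zero => exact hf
  | succ n ih =>
    rw [pow_succ', Module.End.mul_apply]
    exact opX_mem ih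

theorem opY_mem (hf : f ∈ QM) : opY f ∈ QM :=
  extend_mem_QM id modY_mem hf

theorem qslash_mul (α : GL(2, ℚ)⁺) (hf : f ∈ QM) (hg : g ∈ QM) :
    qslash α (f * g) = qslash α f * qslash α g :=
  extend_mul_of_map_mul (fun k l a b => slash_mul k l α a b) hf hg

theorem opX_mul (hf : f ∈ QM) (hg : g ∈ QM) : opX (f * g) = opX f * g + f * opX g := by
  refine extend_mul_of_leibniz (fun k l a b => ?_) hf hg
  rw [modX_eq_serreDerivative, modX_eq_serreDerivative, modX_eq_serreDerivative]
  push_cast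
  exact Derivative.serreDerivative_mul _ _ _ _ (mdiff_of_mem_modularTower a.2)
    (mdiff_of_mem_modularTower b.2)

theorem opY_mul (hf : f ∈ QM) (hg : g ∈ QM) : opY (f * g) = opY f * g + f * opY g := by
  refine extend_mul_of_leibniz (fun k l a b => ?_) hf hg
  ext z
  simp only [modY, LinearMap.smul_apply, Submodule.subtype_apply, Pi.smul_apply, Pi.mul_apply,
    Pi.add_apply, smul_eq_mul]
  push_cast
  ring

theorem qslash_qslash (α β : GL(2, ℚ)⁺) (hf : f ∈ QM) :
    qslash β (qslash α f) = qslash (α * β) f := by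
  refine eq_on_QM (L := qslash β ∘ₗ qslash α) (fun k i a ha => ?_) hf
  rw [LinearMap.comp_apply, qslash_mul_eisG2_pow _ ha,
    qslash_mul_eisG2_pow _ (slash_mem_modularTower α ha), qslash_mul_eisG2_pow _ ha, slash_slash]

theorem qslash_one (hf : f ∈ QM) : qslash 1 f = f := by
  refine eq_on_QM (L' := LinearMap.id) (fun k i a ha => ?_) hf
  rw [qslash_mul_eisG2_pow _ ha, slash_one, LinearMap.id_apply]

theorem qslash_ne_zero (α : GL(2, ℚ)⁺) (hf : f ∈ QM) (hf₀ : f ≠ 0) : qslash α f ≠ 0 := by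
  intro h
  rw [← qslash_one hf, ← mul_inv_cancel α, ← qslash_qslash _ _ hf, h, map_zero] at hf₀
  exact hf₀ rfl

theorem opY_qslash (α : GL(2, ℚ)⁺) (hf : f ∈ QM) : opY (qslash α f) = qslash α (opY f) := by
  refine eq_on_QM (L := opY ∘ₗ qslash α) (L' := qslash α ∘ₗ opY) (fun k i a ha => ?_) hf
  rw [LinearMap.comp_apply, LinearMap.comp_apply, qslash_mul_eisG2_pow _ ha,
    opY_mul_eisG2_pow (slash_mem_modularTower α ha), opY_mul_eisG2_pow ha, map_smul,
    qslash_mul_eisG2_pow _ ha]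

theorem opX_qslash (α : GL(2, ℚ)⁺) (hf : f ∈ QM) :
    opX (qslash α f) = qslash α (opX f) + mu α * opY (qslash α f) := by
  refine eq_on_QM (L := opX ∘ₗ qslash α)
    (L' := qslash α ∘ₗ opX + LinearMap.mulLeft ℂ (mu α) ∘ₗ opY ∘ₗ qslash α)
    (fun k i a ha => ?_) hf
  simp only [LinearMap.comp_apply, LinearMap.add_apply, LinearMap.mulLeft_apply]
  rw [qslash_mul_eisG2_pow _ ha, opX_mul_eisG2_pow (slash_mem_modularTower α ha),
    opX_mul_eisG2_pow ha, qslash_mul_eisG2_pow _ (modX_mem k ⟨a, ha⟩),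
    opY_mul_eisG2_pow (slash_mem_modularTower α ha), modX_slash k α ⟨a, ha⟩, add_mul,
    ← smul_mul_assoc, ← mul_assoc]
  rfl

theorem opY_opX (hf : f ∈ QM) : opY (opX f) = opX (opY f) + opX f := by
  refine eq_on_QM (L := opY ∘ₗ opX) (L' := opX ∘ₗ opY + opX) (fun k i a ha => ?_) hf
  simp only [LinearMap.comp_apply, LinearMap.add_apply]
  rw [opY_mul_eisG2_pow ha, map_smul, opX_mul_eisG2_pow ha,
    opY_mul_eisG2_pow (modX_mem k ⟨a, ha⟩)]
  push_cast
  module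

theorem opX_qslash_toGLQ (γ : SL(2, ℤ)) (hf : f ∈ QM) :
    opX (qslash (toGLQ γ) f) = qslash (toGLQ γ) (opX f) := by
  rw [opX_qslash _ hf, mu_toGLQ, zero_mul, add_zero]

theorem opX_pow_qslash_toGLQ (γ : SL(2, ℤ)) (hf : f ∈ QM) (n : ℕ) :
    (opX ^ n) (qslash (toGLQ γ) f) = qslash (toGLQ γ) ((opX ^ n) f) := by
  induction n with
  | zero => rfl
  | succ n ih =>
    rw [pow_succ', Module.End.mul_apply, Module.End.mul_apply, ih,
      opX_qslash_toGLQ γ (opX_pow_mem hf n)]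

end OnQM

theorem mu_mem_QM (δ : GL(2, ℚ)⁺) : mu δ ∈ QM :=
  mem_QM_of_mem_modularTower (mu_mem δ)

theorem mu_mul_eq_qslash (α β : GL(2, ℚ)⁺) : mu (α * β) = qslash β (mu α) + mu β := by
  rw [qslash_of_mem_modularTower β (mu_mem α), mu_mul]

theorem mu_mul_toGLQ_eq_qslash (α : GL(2, ℚ)⁺) (γ : SL(2, ℤ)) :
    mu (α * toGLQ γ) = qslash (toGLQ γ) (mu α) := by
  rw [mu_mul_eq_qslash, mu_toGLQ, add_zero]

theorem opY_opX_pow_mu (δ : GL(2, ℚ)⁺) (n : ℕ) :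
    opY ((opX ^ n) (mu δ)) = ((n : ℂ) + 1) • (opX ^ n) (mu δ) := by
  induction n with
  | zero => simp [opY_of_mem_modularTower (mu_mem δ)]
  | succ n ih =>
    rw [pow_succ', Module.End.mul_apply, opY_opX (opX_pow_mem (mu_mem_QM δ) n), ih, map_smul]
    push_cast
    module

/-! ### The product of quasimodular Hecke operators -/

theorem finsum_comm_of_finite {ι κ M : Type*} [AddCommMonoid M] {f : ι → κ → M} {s : Set ι}
    (hs : s.Finite) (hfs : ∀ i ∉ s, f i = 0) (hf : ∀ i, (f i).HasFiniteSupport) :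
    ∑ᶠ j, ∑ᶠ i, f i j = ∑ᶠ i, ∑ᶠ j, f i j := by
  have hinner (j : κ) : ∑ᶠ i, f i j = ∑ i ∈ hs.toFinset, f i j := by
    refine finsum_eq_sum_of_support_subset _ fun i hi => ?_
    rw [Set.Finite.coe_toFinset]
    exact not_imp_comm.mp (hfs i) fun h => hi (congrFun h j)
  have houter : ∑ᶠ i, ∑ᶠ j, f i j = ∑ i ∈ hs.toFinset, ∑ᶠ j, f i j := by
    refine finsum_eq_sum_of_support_subset _ fun i hi => ?_
    rw [Set.Finite.coe_toFinset]
    refine not_imp_comm.mp (hfs i) fun h => hi ?_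
    simp only [h, Pi.zero_apply, finsum_zero]
  rw [finsum_congr hinner, houter]
  exact finsum_sum_comm _ _ fun i _ => hf i

section Cosets

variable {N : ℕ} {M : Type*} {v : GL(2, ℚ)⁺ → M}

theorem coset_mk_eq_mk_iff {a b : GL(2, ℚ)⁺} :
    (Quotient.mk _ a : Cosets N) = Quotient.mk _ b ↔ ∃ γ ∈ Gamma N, b = toGLQ γ * a := by
  rw [Quotient.eq, QuotientGroup.rightRel_apply]
  constructor
  · rintro ⟨γ, hγ, h⟩
    exact ⟨γ, hγ, by rw [h, inv_mul_cancel_right]⟩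
  · rintro ⟨γ, hγ, rfl⟩
    exact ⟨γ, hγ, by rw [mul_inv_cancel_right]⟩

theorem exists_eq_toGLQ_mul_out (N : ℕ) (a : GL(2, ℚ)⁺) :
    ∃ γ ∈ Gamma N, a = toGLQ γ * (Quotient.mk _ a : Cosets N).out :=
  coset_mk_eq_mk_iff.mp (Quotient.out_eq _)

/-- Right translation by `τ` on `Γ(N) \ GL₂⁺(ℚ)`. -/
def cosetMulRight (N : ℕ) (τ : GL(2, ℚ)⁺) : Cosets N ≃ Cosets N :=
  Quotient.congr (Equiv.mulRight τ) fun a b => by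
    change QuotientGroup.rightRel (GammaQ N) a b ↔
      QuotientGroup.rightRel (GammaQ N) (a * τ) (b * τ)
    rw [QuotientGroup.rightRel_apply, QuotientGroup.rightRel_apply, mul_inv_rev, mul_assoc,
      mul_inv_cancel_left]

theorem cosetMulRight_mk (τ a : GL(2, ℚ)⁺) :
    cosetMulRight N τ (Quotient.mk _ a) = Quotient.mk _ (a * τ) := rfl

theorem cosetMulRight_eq_mk (τ : GL(2, ℚ)⁺) (c : Cosets N) :
    cosetMulRight N τ c = Quotient.mk _ (c.out * τ) := by
  rw [← cosetMulRight_mk, Quotient.out_eq]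

/-- Invariance under left multiplication by `Γ(N)`: such a `v` descends to `Γ(N) \ GL₂⁺(ℚ)`. -/
def IsLeftInvariant (N : ℕ) (v : GL(2, ℚ)⁺ → M) : Prop :=
  ∀ γ ∈ Gamma N, ∀ β, v (toGLQ γ * β) = v β

theorem IsLeftInvariant.apply_out (hv : IsLeftInvariant N v) (a : GL(2, ℚ)⁺) :
    v (Quotient.mk _ a : Cosets N).out = v a := by
  obtain ⟨γ, hγ, h⟩ := exists_eq_toGLQ_mul_out N a
  conv_rhs => rw [h]
  exact (hv γ hγ _).symm

theorem IsLeftInvariant.finsum_out_mul [AddCommMonoid M] (hv : IsLeftInvariant N v)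
    (τ : GL(2, ℚ)⁺) : ∑ᶠ c : Cosets N, v (c.out * τ) = ∑ᶠ c : Cosets N, v c.out := by
  rw [← finsum_comp_equiv (cosetMulRight N τ) (f := fun c => v c.out)]
  refine finsum_congr fun c => ?_
  rw [cosetMulRight_eq_mk, hv.apply_out]

end Cosets

section HeckeProduct

variable {N : ℕ} {σ : SL(2, ℤ)} {F F' G G' H : GL(2, ℚ)⁺ → ℍ → ℂ}

theorem finite_setOf_apply_out_mul_ne_zero (hF : F ∈ Q N σ) (τ : GL(2, ℚ)⁺) :
    {c : Cosets N | F (c.out * τ) ≠ 0}.Finite := by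
  refine (hF.2.2.1.preimage (cosetMulRight N τ).injective.injOn).subset fun c hc => ?_
  exact ⟨c.out * τ, hc, (cosetMulRight_eq_mk τ c).symm⟩

theorem isLeftInvariant_of_mem_Q (hF : F ∈ Q N σ) : IsLeftInvariant N F := hF.2.1

theorem apply_mul_toGLQ (hF : F ∈ Q N 1) {γ : SL(2, ℤ)} (hγ : γ ∈ Gamma N) (α : GL(2, ℚ)⁺) :
    F (α * toGLQ γ) = qslash (toGLQ γ) (F α) := by
  rw [hF.2.2.2 γ hγ α, one_mul, inv_one, mul_one]

theorem isLeftInvariant_qslash_apply_mul_inv (hG : G ∈ Q N 1) (α : GL(2, ℚ)⁺) :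
    IsLeftInvariant N fun β => qslash β (G (α * β⁻¹)) := by
  intro γ hγ β
  dsimp only
  rw [mul_inv_rev, ← map_inv toGLQ γ, ← mul_assoc α β⁻¹,
    apply_mul_toGLQ hG ((Gamma N).inv_mem hγ), qslash_qslash _ _ (hG.1 _), ← mul_assoc, ← map_mul,
    inv_mul_cancel, map_one, one_mul]

/-- The summand `F_{βσ} · (G_{ασ⁻¹β⁻¹} || β)` of `(F ∗ G)_α`. -/
def heckeTerm (σ : SL(2, ℤ)) (F G : GL(2, ℚ)⁺ → ℍ → ℂ) (α β : GL(2, ℚ)⁺) : ℍ → ℂ :=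
  F (β * toGLQ σ) * qslash β (G (α * (toGLQ σ)⁻¹ * β⁻¹))

theorem heckeMul_eq_finsum_heckeTerm (α : GL(2, ℚ)⁺) :
    heckeMul N σ F G α = ∑ᶠ c : Cosets N, heckeTerm σ F G α c.out := rfl

theorem isLeftInvariant_heckeTerm (hF : F ∈ Q N σ) (hG : G ∈ Q N 1) (α : GL(2, ℚ)⁺) :
    IsLeftInvariant N (heckeTerm σ F G α) := by
  intro γ hγ β
  exact congrArg₂ (· * ·) (by rw [mul_assoc, isLeftInvariant_of_mem_Q hF γ hγ])
    (isLeftInvariant_qslash_apply_mul_inv hG (α * (toGLQ σ)⁻¹) γ hγ β)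

theorem hasFiniteSupport_heckeTerm (hF : F ∈ Q N σ) (G : GL(2, ℚ)⁺ → ℍ → ℂ) (α : GL(2, ℚ)⁺) :
    (fun c : Cosets N => heckeTerm σ F G α c.out).HasFiniteSupport :=
  (finite_setOf_apply_out_mul_ne_zero hF (toGLQ σ)).subset fun _ hc =>
    left_ne_zero_of_mul hc

theorem heckeTerm_mem_QM (hF : F ∈ Q N σ) (hG : G ∈ Q N 1) (α β : GL(2, ℚ)⁺) :
    heckeTerm σ F G α β ∈ QM :=
  mul_mem_QM (hF.1 _) (qslash_mem _ (hG.1 _))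

theorem exists_ne_zero_of_heckeMul_ne_zero {α : GL(2, ℚ)⁺} (h : heckeMul N σ F G α ≠ 0) :
    ∃ x, F x ≠ 0 ∧ G (α * x⁻¹) ≠ 0 := by
  obtain ⟨c, hc⟩ : ∃ c : Cosets N, heckeTerm σ F G α c.out ≠ 0 :=
    not_forall.mp (mt finsum_eq_zero_of_forall_eq_zero h)
  refine ⟨c.out * toGLQ σ, left_ne_zero_of_mul hc, fun hG => right_ne_zero_of_mul hc ?_⟩
  rw [mul_assoc, ← mul_inv_rev, hG, map_zero]

theorem finite_image_support_heckeMul (hF : F ∈ Q N σ) (hG : G ∈ Q N 1) :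
    ((fun α => (Quotient.mk _ α : Cosets N)) '' (heckeMul N σ F G).support).Finite := by
  refine (hF.2.2.1.biUnion fun c _ => hG.2.2.1.image (cosetMulRight N c.out)).subset ?_
  rintro _ ⟨α, hα, rfl⟩
  obtain ⟨x, hFx, hGx⟩ := exists_ne_zero_of_heckeMul_ne_zero hα
  obtain ⟨γ, hγ, hxγ⟩ := exists_eq_toGLQ_mul_out N x
  have hGγ : G (α * x⁻¹ * toGLQ γ) ≠ 0 := by
    rw [apply_mul_toGLQ hG hγ]
    exact qslash_ne_zero _ (hG.1 _) hGx
  refine Set.mem_biUnion ⟨x, hFx, rfl⟩ ⟨Quotient.mk _ (α * x⁻¹ * toGLQ γ), ⟨_, hGγ, rfl⟩, ?_⟩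
  rw [cosetMulRight_mk, mul_assoc, ← hxγ, inv_mul_cancel_right]

theorem qslash_heckeTerm (hF : F ∈ Q N σ) (hG : G ∈ Q N 1) {γ : SL(2, ℤ)} (hγ : γ ∈ Gamma N)
    (α β : GL(2, ℚ)⁺) : qslash (toGLQ (σ * γ * σ⁻¹)) (heckeTerm σ F G α β) =
      heckeTerm σ F G (α * toGLQ γ) (β * toGLQ (σ * γ * σ⁻¹)) := by
  rw [heckeTerm, qslash_mul _ (hF.1 _) (qslash_mem _ (hG.1 _)), qslash_qslash _ _ (hG.1 _),
    ← hF.2.2.2 γ hγ, heckeTerm]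
  congr 2
  · simp only [map_mul, map_inv]
    group
  · congr 1
    simp only [map_mul, map_inv]
    group

theorem heckeMul_apply_mul_toGLQ (hF : F ∈ Q N σ) (hG : G ∈ Q N 1) {γ : SL(2, ℤ)}
    (hγ : γ ∈ Gamma N) (α : GL(2, ℚ)⁺) :
    heckeMul N σ F G (α * toGLQ γ) = qslash (toGLQ (σ * γ * σ⁻¹)) (heckeMul N σ F G α) := by
  rw [heckeMul_eq_finsum_heckeTerm, heckeMul_eq_finsum_heckeTerm,
    map_finsum _ (hasFiniteSupport_heckeTerm hF G α),
    ← (isLeftInvariant_heckeTerm hF hG (α * toGLQ γ)).finsum_out_mul (toGLQ (σ * γ * σ⁻¹))]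
  exact finsum_congr fun c => (qslash_heckeTerm hF hG hγ α c.out).symm

theorem heckeMul_mem_Q (hF : F ∈ Q N σ) (hG : G ∈ Q N 1) : heckeMul N σ F G ∈ Q N σ := by
  refine ⟨fun α => ?_, fun γ hγ α => ?_, finite_image_support_heckeMul hF hG,
    fun γ hγ α => heckeMul_apply_mul_toGLQ hF hG hγ α⟩
  · exact finsum_induction (· ∈ QM) QM.zero_mem (fun _ _ => QM.add_mem) fun c =>
      heckeTerm_mem_QM hF hG α c.out
  · simp only [heckeMul, mul_assoc, isLeftInvariant_of_mem_Q hG γ hγ]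

theorem heckeMul_add_left (hF : F ∈ Q N σ) (hF' : F' ∈ Q N σ) (G : GL(2, ℚ)⁺ → ℍ → ℂ) :
    heckeMul N σ (F + F') G = heckeMul N σ F G + heckeMul N σ F' G := by
  ext1 α
  refine (finsum_congr fun c => ?_).trans (finsum_add_distrib (hasFiniteSupport_heckeTerm hF G α)
    (hasFiniteSupport_heckeTerm hF' G α))
  rw [Pi.add_apply, add_mul]

theorem heckeMul_add_right (hF : F ∈ Q N σ) (G G' : GL(2, ℚ)⁺ → ℍ → ℂ) :
    heckeMul N σ F (G + G') = heckeMul N σ F G + heckeMul N σ F G' := by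
  ext1 α
  refine (finsum_congr fun c => ?_).trans (finsum_add_distrib (hasFiniteSupport_heckeTerm hF G α)
    (hasFiniteSupport_heckeTerm hF G' α))
  rw [Pi.add_apply, map_add, mul_add]

theorem heckeMul_smul_left (r : ℂ) (F G : GL(2, ℚ)⁺ → ℍ → ℂ) :
    heckeMul N σ (r • F) G = r • heckeMul N σ F G := by
  ext1 α
  simp only [heckeMul, Pi.smul_apply, smul_mul_assoc, smul_finsum]

theorem heckeMul_smul_right (r : ℂ) (F G : GL(2, ℚ)⁺ → ℍ → ℂ) :
    heckeMul N σ F (r • G) = r • heckeMul N σ F G := by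
  ext1 α
  simp only [heckeMul, Pi.smul_apply, map_smul, mul_smul_comm, smul_finsum]

/-- The product `F¹ ∗ F²` as a bilinear map. -/
def heckeMulHom (N : ℕ) (σ : SL(2, ℤ)) : Q N σ →ₗ[ℂ] Q N 1 →ₗ[ℂ] Q N σ :=
  LinearMap.mk₂ ℂ (fun F G => ⟨heckeMul N σ F.1 G.1, heckeMul_mem_Q F.2 G.2⟩)
    (fun F F' G => Subtype.ext (heckeMul_add_left F.2 F'.2 G.1))
    (fun r F G => Subtype.ext (heckeMul_smul_left r F.1 G.1))
    (fun F G G' => Subtype.ext (heckeMul_add_right F.2 G.1 G'.1))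
    (fun r F G => Subtype.ext (heckeMul_smul_right r F.1 G.1))

theorem heckeMulHom_apply (F : Q N σ) (G : Q N 1) (α : GL(2, ℚ)⁺) :
    (heckeMulHom N σ F G).1 α = heckeMul N σ F.1 G.1 α := rfl

/-- The summand of the triple product: `F_{δσ} · (G_{βδ⁻¹} || δ) · (H_{ασ⁻¹β⁻¹} || β)`. -/
def heckeTriple (σ : SL(2, ℤ)) (F G H : GL(2, ℚ)⁺ → ℍ → ℂ) (α δ β : GL(2, ℚ)⁺) : ℍ → ℂ :=
  F (δ * toGLQ σ) * qslash δ (G (β * δ⁻¹)) * qslash β (H (α * (toGLQ σ)⁻¹ * β⁻¹))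

theorem isLeftInvariant_heckeTriple (hG : G ∈ Q N 1) (hH : H ∈ Q N 1)
    (F : GL(2, ℚ)⁺ → ℍ → ℂ) (α δ : GL(2, ℚ)⁺) : IsLeftInvariant N (heckeTriple σ F G H α δ) := by
  intro γ hγ β
  exact congrArg₂ (· * ·) (by rw [mul_assoc, isLeftInvariant_of_mem_Q hG γ hγ])
    (isLeftInvariant_qslash_apply_mul_inv hH (α * (toGLQ σ)⁻¹) γ hγ β)

theorem hasFiniteSupport_heckeTriple (hG : G ∈ Q N 1) (F H : GL(2, ℚ)⁺ → ℍ → ℂ)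
    (α δ : GL(2, ℚ)⁺) : (fun c : Cosets N => heckeTriple σ F G H α δ c.out).HasFiniteSupport := by
  refine (finite_setOf_apply_out_mul_ne_zero hG δ⁻¹).subset fun c hc h₀ => hc ?_
  simp only [heckeTriple, h₀, map_zero, mul_zero, zero_mul]

theorem heckeTerm_heckeMul_left (hF : F ∈ Q N σ) (G H : GL(2, ℚ)⁺ → ℍ → ℂ) (α β : GL(2, ℚ)⁺) :
    heckeTerm σ (heckeMul N σ F G) H α β = ∑ᶠ d : Cosets N, heckeTriple σ F G H α d.out β := by
  rw [heckeTerm, heckeMul_eq_finsum_heckeTerm, finsum_mul' _ _ (hasFiniteSupport_heckeTerm hF G _)]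
  simp only [heckeTerm, heckeTriple, mul_inv_cancel_right]

theorem heckeTerm_heckeMul_right (hG : G ∈ Q N 1) (hH : H ∈ Q N 1) (F : GL(2, ℚ)⁺ → ℍ → ℂ)
    (α δ : GL(2, ℚ)⁺) : heckeTerm σ F (heckeMul N 1 G H) α δ =
      ∑ᶠ c : Cosets N, heckeTriple σ F G H α δ (c.out * δ) := by
  have hfin := hasFiniteSupport_heckeTerm hG H (α * (toGLQ σ)⁻¹ * δ⁻¹)
  have hfin' : (fun c : Cosets N =>
      qslash δ (heckeTerm 1 G H (α * (toGLQ σ)⁻¹ * δ⁻¹) c.out)).HasFiniteSupport :=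
    hfin.subset fun c hc h₀ => hc (by simp only [h₀, map_zero])
  rw [heckeTerm, heckeMul_eq_finsum_heckeTerm, map_finsum _ hfin, mul_finsum' _ _ hfin']
  refine finsum_congr fun c => ?_
  rw [heckeTerm, qslash_mul _ (hG.1 _) (qslash_mem _ (hH.1 _)), qslash_qslash _ _ (hH.1 _),
    ← mul_assoc, heckeTriple]
  simp only [map_one, mul_one, inv_one, mul_inv_cancel, mul_inv_rev, mul_assoc]

theorem heckeMul_assoc (hF : F ∈ Q N σ) (hG : G ∈ Q N 1) (hH : H ∈ Q N 1) (α : GL(2, ℚ)⁺) :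
    heckeMul N σ (heckeMul N σ F G) H α = heckeMul N σ F (heckeMul N 1 G H) α := by
  have hvanish (d : Cosets N) (hd : d ∉ {d : Cosets N | F (d.out * toGLQ σ) ≠ 0}) :
      (fun c : Cosets N => heckeTriple σ F G H α d.out c.out) = 0 := by
    funext c
    rw [heckeTriple, not_not.mp hd, zero_mul, zero_mul, Pi.zero_apply]
  calc heckeMul N σ (heckeMul N σ F G) H α
      = ∑ᶠ c : Cosets N, ∑ᶠ d : Cosets N, heckeTriple σ F G H α d.out c.out :=
        finsum_congr fun c => heckeTerm_heckeMul_left hF G H α c.out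
    _ = ∑ᶠ d : Cosets N, ∑ᶠ c : Cosets N, heckeTriple σ F G H α d.out c.out :=
        finsum_comm_of_finite (finite_setOf_apply_out_mul_ne_zero hF (toGLQ σ)) hvanish fun d =>
          hasFiniteSupport_heckeTriple hG F H α d.out
    _ = ∑ᶠ d : Cosets N, ∑ᶠ c : Cosets N, heckeTriple σ F G H α d.out (c.out * d.out) :=
        finsum_congr fun d =>
          ((isLeftInvariant_heckeTriple hG hH F α d.out).finsum_out_mul d.out).symm
    _ = heckeMul N σ F (heckeMul N 1 G H) α :=
        finsum_congr fun d => (heckeTerm_heckeMul_right hG hH F α d.out).symm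

end HeckeProduct

/-! ### The action of `𝓗₁` -/

section Action

variable {N : ℕ} {σ : SL(2, ℤ)}

/-- The operator `F ↦ (α ↦ T_α F_α)` on twisted Hecke operators. -/
def pointwiseOp (T : GL(2, ℚ)⁺ → Module.End ℂ (ℍ → ℂ)) (hT : ∀ α, ∀ f ∈ QM, T α f ∈ QM)
    (hTinv : IsLeftInvariant N T)
    (hTslash : ∀ γ ∈ Gamma N, ∀ α, ∀ f ∈ QM, T (α * toGLQ γ) (qslash (toGLQ (σ * γ * σ⁻¹)) f) =
      qslash (toGLQ (σ * γ * σ⁻¹)) (T α f)) : Module.End ℂ (Q N σ) where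
  toFun F := ⟨fun α => T α (F.1 α), fun α => hT α _ (F.2.1 α),
    fun γ hγ α => by simp only [hTinv γ hγ, F.2.2.1 γ hγ],
    F.2.2.2.1.subset (Set.image_mono fun α hα h₀ => hα (by simp only [h₀, map_zero])),
    fun γ hγ α => by simp only [F.2.2.2.2 γ hγ, hTslash γ hγ α _ (F.2.1 α)]⟩
  map_add' F G := Subtype.ext <| funext fun α => map_add (T α) (F.1 α) (G.1 α)
  map_smul' c F := Subtype.ext <| funext fun α => map_smul (T α) c (F.1 α)

theorem mul_toGLQ_mul_inv (σ γ : SL(2, ℤ)) (α : GL(2, ℚ)⁺) :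
    α * toGLQ γ * (toGLQ σ)⁻¹ = α * (toGLQ σ)⁻¹ * toGLQ (σ * γ * σ⁻¹) := by
  simp only [map_mul, map_inv]
  group

variable (N σ)

/-- The action of `X` on `𝒬_σ(Γ(N))`. -/
def actX : Module.End ℂ (Q N σ) :=
  pointwiseOp (fun _ => opX) (fun _ _ => opX_mem) (fun _ _ _ => rfl)
    fun _ _ _ _ hf => opX_qslash_toGLQ _ hf

/-- The action of `Y` on `𝒬_σ(Γ(N))`. -/
def actY : Module.End ℂ (Q N σ) :=
  pointwiseOp (fun _ => opY) (fun _ _ => opY_mem) (fun _ _ _ => rfl)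
    fun _ _ _ _ hf => opY_qslash _ hf

/-- The action of the generator `δ_{n+1}` on `𝒬_σ(Γ(N))`. -/
def actδ (n : ℕ) : Module.End ℂ (Q N σ) :=
  pointwiseOp (fun α => LinearMap.mulLeft ℂ ((opX ^ n) (mu (α * (toGLQ σ)⁻¹))))
    (fun _ _ => mul_mem_QM (opX_pow_mem (mu_mem_QM _) n))
    (fun γ _ α => by simp only [mul_assoc, mu_toGLQ_mul])
    fun γ _ α f hf => by
      rw [LinearMap.mulLeft_apply, LinearMap.mulLeft_apply, mul_toGLQ_mul_inv,
        mu_mul_toGLQ_eq_qslash, opX_pow_qslash_toGLQ _ (mu_mem_QM _),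
        qslash_mul _ (opX_pow_mem (mu_mem_QM _) n) hf]

variable {N σ}

theorem actX_apply (F : Q N σ) (α : GL(2, ℚ)⁺) : (actX N σ F).1 α = opX (F.1 α) := rfl

theorem actY_apply (F : Q N σ) (α : GL(2, ℚ)⁺) : (actY N σ F).1 α = opY (F.1 α) := rfl

theorem actδ_apply (n : ℕ) (F : Q N σ) (α : GL(2, ℚ)⁺) :
    (actδ N σ n F).1 α = (opX ^ n) (mu (α * (toGLQ σ)⁻¹)) * F.1 α := rfl

theorem actY_actX_sub : actY N σ * actX N σ - actX N σ * actY N σ = actX N σ := by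
  refine LinearMap.ext fun F => Subtype.ext <| funext fun α => ?_
  change opY (opX (F.1 α)) - opX (opY (F.1 α)) = opX (F.1 α)
  rw [opY_opX (F.2.1 α), add_sub_cancel_left]

theorem actX_actδ_sub (n : ℕ) :
    actX N σ * actδ N σ n - actδ N σ n * actX N σ = actδ N σ (n + 1) := by
  refine LinearMap.ext fun F => Subtype.ext <| funext fun α => ?_
  set m := mu (α * (toGLQ σ)⁻¹)
  change opX ((opX ^ n) m * F.1 α) - (opX ^ n) m * opX (F.1 α) = (opX ^ (n + 1)) m * F.1 α
  rw [opX_mul (opX_pow_mem (mu_mem_QM _) n) (F.2.1 α), add_sub_cancel_right, pow_succ',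
    Module.End.mul_apply]

theorem actY_actδ_sub (n : ℕ) :
    actY N σ * actδ N σ n - actδ N σ n * actY N σ = ((n : ℂ) + 1) • actδ N σ n := by
  refine LinearMap.ext fun F => Subtype.ext <| funext fun α => ?_
  set m := mu (α * (toGLQ σ)⁻¹)
  change opY ((opX ^ n) m * F.1 α) - (opX ^ n) m * opY (F.1 α) =
    ((n : ℂ) + 1) • ((opX ^ n) m * F.1 α)
  rw [opY_mul (opX_pow_mem (mu_mem_QM _) n) (F.2.1 α), add_sub_cancel_right, opY_opX_pow_mu,
    smul_mul_assoc]

theorem actδ_mul_comm (k l : ℕ) : actδ N σ k * actδ N σ l = actδ N σ l * actδ N σ k :=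
  LinearMap.ext fun _ => Subtype.ext <| funext fun _ => mul_left_comm _ _ _

variable (N σ)

theorem exists_act : ∃ A : H1 →ₐ[ℂ] Module.End ℂ (Q N σ),
    A H1.X = actX N σ ∧ A H1.Y = actY N σ ∧ ∀ n, A (H1.δ n) = actδ N σ n :=
  H1.exists_lift (actX N σ) (actY N σ) (actδ N σ) actY_actX_sub actX_actδ_sub actY_actδ_sub
    actδ_mul_comm

/-- The action of `𝓗₁` on `𝒬_σ(Γ(N))`. -/
def act : H1 →ₐ[ℂ] Module.End ℂ (Q N σ) := (exists_act N σ).choose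

theorem act_X : act N σ H1.X = actX N σ := (exists_act N σ).choose_spec.1

theorem act_Y : act N σ H1.Y = actY N σ := (exists_act N σ).choose_spec.2.1

theorem act_δ (n : ℕ) : act N σ (H1.δ n) = actδ N σ n := (exists_act N σ).choose_spec.2.2 n

end Action

/-! ### Compatibility with the product -/

section Compatibility

variable {N : ℕ} {σ : SL(2, ℤ)} (F : Q N σ) (G : Q N 1) (α β : GL(2, ℚ)⁺)

theorem opX_heckeTerm : opX (heckeTerm σ F.1 G.1 α β) =
    heckeTerm σ (actX N σ F).1 G.1 α β + heckeTerm σ F.1 (actX N 1 G).1 α β +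
      heckeTerm σ (actδ N σ 0 F).1 (actY N 1 G).1 α β := by
  simp only [heckeTerm, actX_apply, actY_apply, actδ_apply, mul_inv_cancel_right, pow_zero,
    Module.End.one_apply]
  rw [opX_mul (F.2.1 _) (qslash_mem _ (G.2.1 _)), opX_qslash _ (G.2.1 _), opY_qslash _ (G.2.1 _)]
  ring

theorem opY_heckeTerm : opY (heckeTerm σ F.1 G.1 α β) =
    heckeTerm σ (actY N σ F).1 G.1 α β + heckeTerm σ F.1 (actY N 1 G).1 α β := by
  simp only [heckeTerm, actY_apply]
  rw [opY_mul (F.2.1 _) (qslash_mem _ (G.2.1 _)), opY_qslash _ (G.2.1 _)]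

theorem mu_mul_heckeTerm : mu (α * (toGLQ σ)⁻¹) * heckeTerm σ F.1 G.1 α β =
    heckeTerm σ (actδ N σ 0 F).1 G.1 α β + heckeTerm σ F.1 (actδ N 1 0 G).1 α β := by
  have hcocycle : mu (α * (toGLQ σ)⁻¹) = qslash β (mu (α * (toGLQ σ)⁻¹ * β⁻¹)) + mu β := by
    rw [← mu_mul_eq_qslash, inv_mul_cancel_right]
  simp only [heckeTerm, actδ_apply, pow_zero, Module.End.one_apply, mul_inv_cancel_right, map_one,
    inv_one, mul_one]
  rw [qslash_mul _ (mu_mem_QM _) (G.2.1 _), hcocycle]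
  ring

theorem actX_heckeMulHom : actX N σ (heckeMulHom N σ F G) =
    heckeMulHom N σ (actX N σ F) G + heckeMulHom N σ F (actX N 1 G) +
      heckeMulHom N σ (actδ N σ 0 F) (actY N 1 G) := by
  refine Subtype.ext <| funext fun α => ?_
  simp only [actX_apply, Submodule.coe_add, Pi.add_apply, heckeMulHom_apply,
    heckeMul_eq_finsum_heckeTerm]
  have hfinX := hasFiniteSupport_heckeTerm (actX N σ F).2 G.1 α
  have hfin (G : Q N 1) := hasFiniteSupport_heckeTerm F.2 G.1 α
  have hfinδ := hasFiniteSupport_heckeTerm (actδ N σ 0 F).2 (actY N 1 G).1 α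
  rw [map_finsum _ (hfin G), ← finsum_add_distrib hfinX (hfin _),
    ← finsum_add_distrib (hfinX.fun_add (hfin _)) hfinδ]
  exact finsum_congr fun c => opX_heckeTerm F G α c.out

theorem actY_heckeMulHom : actY N σ (heckeMulHom N σ F G) =
    heckeMulHom N σ (actY N σ F) G + heckeMulHom N σ F (actY N 1 G) := by
  refine Subtype.ext <| funext fun α => ?_
  simp only [actY_apply, Submodule.coe_add, Pi.add_apply, heckeMulHom_apply,
    heckeMul_eq_finsum_heckeTerm]
  have hfinY := hasFiniteSupport_heckeTerm (actY N σ F).2 G.1 α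
  have hfin (G : Q N 1) := hasFiniteSupport_heckeTerm F.2 G.1 α
  rw [map_finsum _ (hfin G), ← finsum_add_distrib hfinY (hfin _)]
  exact finsum_congr fun c => opY_heckeTerm F G α c.out

theorem actδ_heckeMulHom : actδ N σ 0 (heckeMulHom N σ F G) =
    heckeMulHom N σ (actδ N σ 0 F) G + heckeMulHom N σ F (actδ N 1 0 G) := by
  refine Subtype.ext <| funext fun α => ?_
  rw [actδ_apply]
  simp only [Submodule.coe_add, Pi.add_apply, heckeMulHom_apply, heckeMul_eq_finsum_heckeTerm,
    pow_zero, Module.End.one_apply]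
  have hfinδ := hasFiniteSupport_heckeTerm (actδ N σ 0 F).2 G.1 α
  have hfin (G : Q N 1) := hasFiniteSupport_heckeTerm F.2 G.1 α
  rw [mul_finsum' _ _ (hfin G), ← finsum_add_distrib hfinδ (hfin _)]
  exact finsum_congr fun c => mu_mul_heckeTerm F G α c.out

end Compatibility

/-- The elements of an algebra `A` whose actions on `P` and `M` are intertwined by `μ`. -/
def intertwiningSubalgebra {R A M P : Type*} [CommSemiring R] [Semiring A]
    [Algebra R A] [AddCommMonoid M] [Module R M] [AddCommMonoid P] [Module R P]
    (ρ : A →ₐ[R] Module.End R P) (τ : A →ₐ[R] Module.End R M) (μ : M →ₗ[R] P) : Subalgebra R A where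
  carrier := {a | ∀ x, ρ a (μ x) = μ (τ a x)}
  algebraMap_mem' r x := by simp
  add_mem' ha hb x := by simp [ha x, hb x]
  mul_mem' ha hb x := by simp [ha _, hb x]

section HopfAction

variable (N : ℕ) (σ : SL(2, ℤ))

/-- The action of `𝓗₁ ⊗ 𝓗₁` on `𝒬_σ(Γ(N)) ⊗ 𝒬(Γ(N))`. -/
def actTensor : H1 ⊗[ℂ] H1 →ₐ[ℂ] Module.End ℂ (Q N σ ⊗[ℂ] Q N 1) :=
  (Module.endTensorEndAlgHom (R := ℂ) (A := ℂ) (M := Q N σ) (N := Q N 1)).comp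
    (Algebra.TensorProduct.map (act N σ) (act N 1))

variable {N σ}

theorem actTensor_tmul (a b : H1) (F : Q N σ) (G : Q N 1) :
    actTensor N σ (a ⊗ₜ b) (F ⊗ₜ G) = act N σ a F ⊗ₜ act N 1 b G := rfl

theorem act_lift_heckeMulHom (h : H1) (t : Q N σ ⊗[ℂ] Q N 1) :
    act N σ h (TensorProduct.lift (heckeMulHom N σ) t) =
      TensorProduct.lift (heckeMulHom N σ) (actTensor N σ (H1.comulHom h) t) := by
  set μ := TensorProduct.lift (heckeMulHom N σ)
  have mem_of_tmul {a : H1}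
      (ha : ∀ F G, act N σ a (heckeMulHom N σ F G) = μ (actTensor N σ (H1.comulHom a) (F ⊗ₜ G))) :
      a ∈ intertwiningSubalgebra (act N σ) ((actTensor N σ).comp H1.comulHom) μ :=
    LinearMap.congr_fun <| TensorProduct.ext' (g := act N σ a ∘ₗ μ)
      (h := μ ∘ₗ actTensor N σ (H1.comulHom a)) ha
  refine H1.mem_of_generators _ (mem_of_tmul fun F G => ?_) (mem_of_tmul fun F G => ?_)
    (mem_of_tmul fun F G => ?_) h t
  · rw [H1.comulHom_X, act_X, actX_heckeMulHom]
    simp only [μ, map_add, LinearMap.add_apply, actTensor_tmul, TensorProduct.lift.tmul, act_X,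
      act_Y, act_δ, map_one, Module.End.one_apply]
  · rw [H1.comulHom_Y, act_Y, actY_heckeMulHom]
    simp only [μ, map_add, LinearMap.add_apply, actTensor_tmul, TensorProduct.lift.tmul, act_Y,
      map_one, Module.End.one_apply]
  · rw [H1.comulHom_δ, act_δ, actδ_heckeMulHom]
    simp only [μ, map_add, LinearMap.add_apply, actTensor_tmul, TensorProduct.lift.tmul, act_δ,
      map_one, Module.End.one_apply]

theorem act_heckeMulHom_of_comul_eq {h : H1} {ι : Type*} {s : Finset ι} {h₁ h₂ : ι → H1}
    (hh : Coalgebra.comul (R := ℂ) h = ∑ i ∈ s, h₁ i ⊗ₜ[ℂ] h₂ i) (F : Q N σ) (G : Q N 1) :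
    act N σ h (heckeMulHom N σ F G) =
      ∑ i ∈ s, heckeMulHom N σ (act N σ (h₁ i) F) (act N 1 (h₂ i) G) := by
  have hlift := act_lift_heckeMulHom h (F ⊗ₜ[ℂ] G)
  rw [← H1.comul_eq, hh, map_sum, LinearMap.sum_apply, map_sum] at hlift
  exact hlift

end HopfAction

end QMHecke

end

theorem mainTheorem10 (N : ℕ) (hN : 0 < N) :
    ∃ (mul : ∀ σ : SL(2, ℤ), QMHecke.Q N σ →ₗ[ℂ] QMHecke.Q N 1 →ₗ[ℂ] QMHecke.Q N σ)
      (act : ∀ σ : SL(2, ℤ), QMHecke.H1 →ₐ[ℂ] Module.End ℂ (QMHecke.Q N σ)),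
      -- the product `F¹ ∗ F²` is well defined on `𝒬_σ(Γ) × 𝒬(Γ)` and is a right action of `𝒬(Γ)`
      (∀ (σ : SL(2, ℤ)) (F₁ : QMHecke.Q N σ) (F₂ : QMHecke.Q N 1) (α : GL(2, ℚ)⁺),
        (mul σ F₁ F₂).1 α = QMHecke.heckeMul N σ F₁.1 F₂.1 α) ∧
      (∀ (σ : SL(2, ℤ)) (F₁ : QMHecke.Q N σ) (F₂ F₃ : QMHecke.Q N 1),
        mul σ (mul σ F₁ F₂) F₃ = mul σ F₁ (mul 1 F₂ F₃)) ∧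
      -- the action of the generators; `QMHecke.H1.δ n` is the generator `δ_{n+1}`
      (∀ (σ : SL(2, ℤ)) (F : QMHecke.Q N σ) (α : GL(2, ℚ)⁺),
        (act σ QMHecke.H1.X F).1 α = QMHecke.opX (F.1 α)) ∧
      (∀ (σ : SL(2, ℤ)) (F : QMHecke.Q N σ) (α : GL(2, ℚ)⁺),
        (act σ QMHecke.H1.Y F).1 α = QMHecke.opY (F.1 α)) ∧
      (∀ (σ : SL(2, ℤ)) (n : ℕ) (F : QMHecke.Q N σ) (α : GL(2, ℚ)⁺),
        (act σ (QMHecke.H1.δ n) F).1 α =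
          (QMHecke.opX ^ n) (QMHecke.mu (α * (QMHecke.toGLQ σ)⁻¹)) * F.1 α) ∧
      -- the Hopf action: `h(F¹ ∗ F²) = ∑ h₍₁₎(F¹) ∗ h₍₂₎(F²)`
      (∀ (σ : SL(2, ℤ)) (h : QMHecke.H1) (ι : Type) (s : Finset ι) (h₁ h₂ : ι → QMHecke.H1),
        Coalgebra.comul (R := ℂ) h = ∑ i ∈ s, h₁ i ⊗ₜ[ℂ] h₂ i →
        ∀ (F₁ : QMHecke.Q N σ) (F₂ : QMHecke.Q N 1),
          act σ h (mul σ F₁ F₂) = ∑ i ∈ s, mul σ (act σ (h₁ i) F₁) (act 1 (h₂ i) F₂)) := by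
  refine ⟨QMHecke.heckeMulHom N, QMHecke.act N,
    fun σ F₁ F₂ α => QMHecke.heckeMulHom_apply F₁ F₂ α, fun σ F₁ F₂ F₃ => ?_,
    fun σ F α => ?_, fun σ F α => ?_, fun σ n F α => ?_,
    fun σ h ι s h₁ h₂ hh F₁ F₂ => QMHecke.act_heckeMulHom_of_comul_eq hh F₁ F₂⟩
  · exact Subtype.ext <| funext fun α => QMHecke.heckeMul_assoc F₁.2 F₂.2 F₃.2 α
  · rw [QMHecke.act_X, QMHecke.actX_apply]
  · rw [QMHecke.act_Y, QMHecke.actY_apply]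
  · rw [QMHecke.act_δ, QMHecke.actδ_apply]
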